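/- Let $n\ge 1$, let $\mathcal U(n)$ be the group of unitary $n\times n$ matrices, let $\mathcal U(1)^{\times n}\subset\mathcal U(n)$ be the subgroup of diagonal matrices, and let $\mathcal U_1(n)$ be the set of matrices in $\mathcal U(n)$ all of whose diagonal entries are real and nonnegative. On $\mathcal U_1(n)$ let $\mathrm dG_1=\mathrm dU\cdot U^*$ and let $$[\mathrm dG_1]=\Bigl|\bigwedge_{j<k}\mathrm{Re}(\mathrm dU\cdot U^*)_{jk}\wedge \mathrm{Im}(\mathrm dU\cdot U^*)_{jk}\Bigr|$$ be the measure that this form of degree $n(n-1)$ defines: the measure glued from the pullbacks of the form under injective $C^1$ parametrizations $\varphi:\Omega\to\mathcal U_1(n)$, $\Omega\subset\mathbb R^{n(n-1)}$ open, i.e. the least Borel measure dominating all the measures $E\mapsto\int_{\varphi^{-1}(E)}|\varphi^*(\cdot)|$. Let $$\widetilde\Gamma_n(\alpha)=\int_{X=X^*>0}|\det X|^{\alpha-n}e^{-\mathrm{Tr} X}\,[\mathrm dX]\qquad(\mathrm{Re}\,\alpha>n-1),$$ where $[\mathrm dX]$ is Lebesgue measure in the diagonal entries and in the real and imaginary parts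 of the entries below the diagonal of the positive definite hermitian $n\times n$ matrix $X$. Then $\mathcal U_1(n)$ realises the flag manifold $\mathcal U(n)/\mathcal U(1)^{\times n}$: the map $U\mapsto U\,\mathcal U(1)^{\times n}$ from $\mathcal U_1(n)$ to $\mathcal U(n)/\mathcal U(1)^{\times n}$ is surjective, and it is injective outside a $[\mathrm dG_1]$-null set. Moreover, with the measure on $\mathcal U(n)/\mathcal U(1)^{\times n}$ transported along this map, the volume is finite and $$\mathrm{vol}\bigl(\mathcal U(n)/\mathcal U(1)^{\times n}\bigr)=\mathrm{vol}(\mathcal U_1(n))=\int_{\mathcal U_1(n)}[\mathrm dG_1]=\frac{\pi^{n(n-1)}}{\widetilde\Gamma_n(n)}=\frac{\pi^{n(n-1)/2}}{1!\,2!\cdots(n-1)!}.$$ -/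

import Mathlib

open MeasureTheory
open scoped ENNReal ComplexOrder

noncomputable section

/-! ### The measure `|θ₁ ∧ ⋯ ∧ θₘ|` on a subset of a vector space -/

/-- An injective `C¹` parametrization, with coordinates in an open subset of `ℝ^ι`, of a piece of
the subset `S` of `F`. -/
structure LocalParam (ι : Type) [Fintype ι] {F : Type} [NormedAddCommGroup F] [NormedSpace ℝ F]
    (S : Set F) where
  domain : Set (ι → ℝ)
  toFun : (ι → ℝ) → F
  isOpen_domain : IsOpen domain
  contDiffOn : ContDiffOn ℝ 1 toFun domain
  injOn : Set.InjOn toFun domain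
  mapsTo : Set.MapsTo toFun domain S

/-- The absolute value of the coefficient of the pullback of `⋀ i, θ i` along the
parametrization `p`, i.e. `|det (θ i (∂ₖ p))|`. -/
def LocalParam.density {ι : Type} [Fintype ι] [DecidableEq ι] {F : Type} [NormedAddCommGroup F]
    [NormedSpace ℝ F] {S : Set F} (p : LocalParam ι S) (θ : ι → F → F →ₗ[ℝ] ℝ) (x : ι → ℝ) : ℝ :=
  |(Matrix.of fun i k : ι => θ i (p.toFun x) (fderiv ℝ p.toFun x (Pi.single k 1))).det|

/-- The measure on the image of the parametrization `p` given by integrating `|⋀ i, θ i|`: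
a set `E` gets the mass `∫_{x ∈ domain, p x ∈ E} |det (θ i (∂ₖ p))| dx`. -/
def LocalParam.measure {ι : Type} [Fintype ι] [DecidableEq ι] {F : Type} [NormedAddCommGroup F]
    [NormedSpace ℝ F] [MeasurableSpace F] {S : Set F} (p : LocalParam ι S)
    (θ : ι → F → F →ₗ[ℝ] ℝ) : Measure F :=
  ((volume.restrict p.domain).withDensity
    fun x => ENNReal.ofReal (p.density θ x)).map p.toFun

/-- The measure `|⋀ i, θ i|` on `S`, where the number of real one-forms `θ i` is the dimension of
`S`: the measures given by the parametrizations of pieces of `S` agree on overlaps by the change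
of variables formula, and they are glued by taking the least measure that dominates all of them. -/
def wedgeMeasure {ι : Type} [Fintype ι] [DecidableEq ι] {F : Type} [NormedAddCommGroup F]
    [NormedSpace ℝ F] [MeasurableSpace F] (θ : ι → F → F →ₗ[ℝ] ℝ) (S : Set F) : Measure F :=
  ⨆ p : LocalParam ι S, p.measure θ

/-! ### The flag manifold -/

/-- The Borel `σ`-algebra of the space of matrices. -/
instance matrixMeasurableSpace (n : ℕ) : MeasurableSpace (Matrix (Fin n) (Fin n) ℂ) :=
  borel _

/-- Pairs of indices `j < k`. -/
abbrev UpperPair (n : ℕ) : Type := {p : Fin n × Fin n // p.1 < p.2}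

/-- The subgroup `U(1)^n` of diagonal matrices in `U(n)`. -/
def diagonalTorus (n : ℕ) : Subgroup (Matrix.unitaryGroup (Fin n) ℂ) where
  carrier := {D | (D : Matrix (Fin n) (Fin n) ℂ).IsDiag}
  one_mem' := by
    intro i j hij
    simp [Matrix.one_apply_ne hij]
  mul_mem' := by
    intro A B hA hB i j hij
    change ((A : Matrix (Fin n) (Fin n) ℂ) * (B : Matrix (Fin n) (Fin n) ℂ)) i j = 0
    rw [Matrix.mul_apply]
    refine Finset.sum_eq_zero fun l _ => ?_
    by_cases h : i = l
    · subst h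
      rw [hB hij, mul_zero]
    · rw [hA h, zero_mul]
  inv_mem' := by
    intro A hA i j hij
    change star ((A : Matrix (Fin n) (Fin n) ℂ) j i) = 0
    rw [hA (Ne.symm hij), star_zero]

/-- The flag manifold `U(n) / U(1)^n`, the space of cosets `U · U(1)^n`. -/
abbrev FlagManifold (n : ℕ) : Type := Matrix.unitaryGroup (Fin n) ℂ ⧸ diagonalTorus n

/-- The set `U₁(n)` of unitary matrices whose diagonal entries are real and nonnegative. -/
def realDiagUnitary (n : ℕ) : Set (Matrix (Fin n) (Fin n) ℂ) :=
  {U | U ∈ Matrix.unitaryGroup (Fin n) ℂ ∧ ∀ j, (U j j).im = 0 ∧ 0 ≤ (U j j).re}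

/-- The map `U₁(n) → U(n) / U(1)^n` sending a matrix to its coset. -/
def toFlag (n : ℕ) (V : realDiagUnitary n) : FlagManifold n :=
  QuotientGroup.mk (⟨V.1, V.2.1⟩ : Matrix.unitaryGroup (Fin n) ℂ)

/-- The real and imaginary parts of the entries above the diagonal of `dG₁ = dU · U*`: at the
point `U`, the tangent vector `A` is sent to `Re (A U*)_{jk}` and to `Im (A U*)_{jk}`, `j < k`. -/
def dGForm (n : ℕ) :
    UpperPair n ⊕ UpperPair n → Matrix (Fin n) (Fin n) ℂ → Matrix (Fin n) (Fin n) ℂ →ₗ[ℝ] ℝ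
  | Sum.inl p, U =>
    { toFun := fun A => ((A * U.conjTranspose) p.1.1 p.1.2).re
      map_add' := by intro A B; simp [add_mul]
      map_smul' := by intro c A; simp }
  | Sum.inr p, U =>
    { toFun := fun A => ((A * U.conjTranspose) p.1.1 p.1.2).im
      map_add' := by intro A B; simp [add_mul]
      map_smul' := by intro c A; simp }

section

-- All norms on this finite-dimensional space give the same derivatives.
attribute [local instance] Matrix.normedAddCommGroup Matrix.normedSpace

/-- The measure `[dG₁] = |⋀_{j<k} Re (dU · U*)_{jk} ∧ Im (dU · U*)_{jk}|` on `U₁(n)`. -/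
def dGMeasure (n : ℕ) : Measure (realDiagUnitary n) :=
  (wedgeMeasure (dGForm n) (realDiagUnitary n)).comap Subtype.val

end

/-- The measure `[dG₁]` on the flag manifold, transported from `U₁(n)`. -/
def flagMeasure (n : ℕ) : Measure (FlagManifold n) := (dGMeasure n).map (toFlag n)

/-! ### The complex matrix-variate gamma function -/

/-- The hermitian matrix with diagonal `x` and entries `z` below the diagonal. -/
def hermitianOf {n : ℕ} (x : Fin n → ℝ) (z : UpperPair n → ℂ) : Matrix (Fin n) (Fin n) ℂ :=
  Matrix.of fun j k =>
    if h : k < j then z ⟨(k, j), h⟩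
    else if h' : j < k then star (z ⟨(j, k), h'⟩)
    else (x j : ℂ)

/-- `Γ̃ₙ(α) = ∫_{X > 0} |det X|^(α - n) e^(-tr X) [dX]`, the integral being over the positive
definite hermitian `n × n` matrices, with Lebesgue measure in the (real) diagonal entries and in
the real and imaginary parts of the entries below the diagonal. -/
def complexMatrixGamma (n : ℕ) (α : ℂ) : ℂ :=
  ∫ w in {w : (Fin n → ℝ) × (UpperPair n → ℂ) | (hermitianOf w.1 w.2).PosDef},
    ((‖(hermitianOf w.1 w.2).det‖ : ℝ) : ℂ) ^ (α - n) *
      Complex.exp (-(hermitianOf w.1 w.2).trace)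

end

/-! Almost every complex `n × n` matrix factors uniquely as `Z = T U` with `T` lower triangular and
invertible and `U` in `U₁(n)` with positive diagonal. The dimensions add up: `n(n+1) + n(n-1) =
2n²`. The volume of `U₁(n)` is found by computing the integral of `exp (-tr Z Z*)` in two ways.

Jacobian: `dZ · U* = dT + T · (dU · U*)`. Only the second term has entries above the diagonal, and
they depend only on the entries of `dG₁` above the diagonal. With `j` counted from `0`, the Jacobian
is `∏ |t_jj|^(2(n-1-j))` times the coefficient of the form (`det_frameMap`,
`abs_det_lowerMulDeriv`). The Gaussian depends on `T` alone, so the Gaussian mass of the matrices `T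
U`, with `U` in a piece of `U₁(n)`, is the measure of the piece times a constant
(`LocalParam.lintegral_gauss_image`). The whole space has mass `π^(n²)` and the constant is
`π^(n(n+1)/2) ∏ (n-1-j)!`; their quotient is the volume.

The measure is a supremum over all parametrizations, so two more facts are needed. The form vanishes
where a diagonal entry of `U` is zero (`LocalParam.density_eq_zero`); this also makes the
non-injective locus of `toFlag` null. One chart suffices: Gram-Schmidt applied to the rows of upper
unipotent matrices, with phases adjusted, reaches almost every `Z` after left multiplication by
lower triangular matrices (`ae_mem_image_chart`), so its measure dominates all the others
(`LocalParam.measure_le_chart`).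

At `α = n` the determinant drops out of the gamma integral. Splitting off the first row and column
by a Schur complement gives the factor `π^k k!` in passing from size `k` to size `k + 1`
(`lintegral_expTrace_succ`), hence `π^(n(n-1)/2) ∏ k!`. -/

noncomputable section

attribute [local instance] Matrix.normedAddCommGroup Matrix.normedSpace

open scoped ContDiff InnerProductSpace

/-! ### Coordinates on the space of matrices -/

/-- Coordinates of a lower triangular matrix: its diagonal and the entries below it. -/
abbrev LowerCoord (n : ℕ) : Type := (Fin n → ℂ) × (UpperPair n → ℂ)

/-- Coordinates of a strictly upper triangular matrix: real and imaginary parts of the entries. -/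
abbrev UpperCoord (n : ℕ) : Type := UpperPair n ⊕ UpperPair n → ℝ

/-- The lower triangular matrix with given coordinates. -/
def lowerMatrix {n : ℕ} : LowerCoord n →ₗ[ℝ] Matrix (Fin n) (Fin n) ℂ where
  toFun t := Matrix.of fun j k =>
    if h : k < j then t.2 ⟨(k, j), h⟩ else if j < k then 0 else t.1 j
  map_add' s t := by
    ext j k
    simp only [Matrix.of_apply, Matrix.add_apply]
    split_ifs <;> simp
  map_smul' c t := by
    ext j k
    simp only [Matrix.of_apply, Matrix.smul_apply]
    split_ifs <;> simp

/-- The strictly upper triangular matrix with given coordinates. -/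
def upperMatrix {n : ℕ} : UpperCoord n →ₗ[ℝ] Matrix (Fin n) (Fin n) ℂ where
  toFun x := Matrix.of fun j k =>
    if h : j < k then (⟨x (Sum.inl ⟨(j, k), h⟩), x (Sum.inr ⟨(j, k), h⟩)⟩ : ℂ) else 0
  map_add' s t := by
    ext j k
    simp only [Matrix.of_apply, Matrix.add_apply]
    split_ifs <;> simp [Complex.ext_iff]
  map_smul' c t := by
    ext j k
    simp only [Matrix.of_apply, Matrix.smul_apply]
    split_ifs <;> simp [Complex.ext_iff]

/-- The coordinates of the part of a matrix above the diagonal. -/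
def upperPart {n : ℕ} : Matrix (Fin n) (Fin n) ℂ →ₗ[ℝ] UpperCoord n where
  toFun M := Sum.elim (fun p => (M p.1.1 p.1.2).re) (fun p => (M p.1.1 p.1.2).im)
  map_add' M N := by ext (p | p) <;> simp
  map_smul' c M := by ext (p | p) <;> simp

/-- The coordinates of the part of a matrix on and below the diagonal. -/
def lowerPart {n : ℕ} : Matrix (Fin n) (Fin n) ℂ →ₗ[ℝ] LowerCoord n where
  toFun M := (fun j => M j j, fun p => M p.1.2 p.1.1)
  map_add' _ _ := rfl
  map_smul' _ _ := rfl

variable {n : ℕ}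

theorem lowerPart_fst (M : Matrix (Fin n) (Fin n) ℂ) (j : Fin n) : (lowerPart M).1 j = M j j := rfl

theorem lowerPart_snd (M : Matrix (Fin n) (Fin n) ℂ) (p : UpperPair n) :
    (lowerPart M).2 p = M p.1.2 p.1.1 := rfl

theorem lowerMatrix_diag (t : LowerCoord n) (j : Fin n) : lowerMatrix t j j = t.1 j := by
  simp [lowerMatrix]

theorem lowerMatrix_below (t : LowerCoord n) {j k : Fin n} (h : k < j) :
    lowerMatrix t j k = t.2 ⟨(k, j), h⟩ := by
  simp [lowerMatrix, h]

theorem lowerMatrix_above (t : LowerCoord n) {j k : Fin n} (h : j < k) :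
    lowerMatrix t j k = 0 := by
  simp [lowerMatrix, h, h.le]

theorem upperMatrix_above (x : UpperCoord n) {j k : Fin n} (h : j < k) :
    upperMatrix x j k = ⟨x (Sum.inl ⟨(j, k), h⟩), x (Sum.inr ⟨(j, k), h⟩)⟩ := by
  simp [upperMatrix, h]

theorem upperMatrix_of_le (x : UpperCoord n) {j k : Fin n} (h : k ≤ j) :
    upperMatrix x j k = 0 := by
  simp [upperMatrix, h]

theorem upperPart_lowerMatrix (t : LowerCoord n) : upperPart (lowerMatrix t) = 0 := by
  ext (p | p) <;> simp [upperPart, lowerMatrix_above t p.2]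

theorem lowerPart_lowerMatrix (t : LowerCoord n) : lowerPart (lowerMatrix t) = t := by
  refine Prod.ext ?_ ?_ <;> ext p
  · simp [lowerPart_fst, lowerMatrix_diag]
  · simp [lowerPart_snd, lowerMatrix_below t p.2]

theorem upperPart_upperMatrix (x : UpperCoord n) : upperPart (upperMatrix x) = x := by
  ext (p | p) <;> simp [upperPart, upperMatrix_above x p.2]

theorem lowerPart_upperMatrix (x : UpperCoord n) : lowerPart (upperMatrix x) = 0 := by
  refine Prod.ext ?_ ?_ <;> ext p
  · simp [lowerPart_fst, upperMatrix_of_le]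
  · simp [lowerPart_snd, upperMatrix_of_le x p.2.le]

theorem upperMatrix_add_lowerMatrix (M : Matrix (Fin n) (Fin n) ℂ) :
    upperMatrix (upperPart M) + lowerMatrix (lowerPart M) = M := by
  ext j k
  rcases lt_trichotomy j k with h | rfl | h
  · simp [upperMatrix_above _ h, lowerMatrix_above _ h, upperPart]
  · simp [upperMatrix_of_le, lowerMatrix_diag, lowerPart_fst]
  · simp [upperMatrix_of_le _ h.le, lowerMatrix_below _ h, lowerPart_snd]

/-- Real coordinates on the space of matrices. -/
def coordEquiv (n : ℕ) : Matrix (Fin n) (Fin n) ℂ ≃ₗ[ℝ] UpperCoord n × LowerCoord n where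
  toFun M := (upperPart M, lowerPart M)
  invFun w := upperMatrix w.1 + lowerMatrix w.2
  map_add' M N := by simp
  map_smul' c M := by simp
  left_inv M := upperMatrix_add_lowerMatrix M
  right_inv w := by
    simp [upperPart_lowerMatrix, lowerPart_lowerMatrix, upperPart_upperMatrix,
      lowerPart_upperMatrix]

theorem coordEquiv_apply (M : Matrix (Fin n) (Fin n) ℂ) :
    coordEquiv n M = (upperPart M, lowerPart M) := rfl

theorem coordEquiv_symm_apply (w : UpperCoord n × LowerCoord n) :
    (coordEquiv n).symm w = upperMatrix w.1 + lowerMatrix w.2 := rfl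

/-! ### Triangular matrices -/

/-- The entries above the diagonal vanish. -/
def IsLower (M : Matrix (Fin n) (Fin n) ℂ) : Prop := ∀ ⦃j k⦄, j < k → M j k = 0

theorem isLower_lowerMatrix (t : LowerCoord n) : IsLower (lowerMatrix t) :=
  fun _ _ h => lowerMatrix_above t h

theorem IsLower.eq_lowerMatrix {M : Matrix (Fin n) (Fin n) ℂ} (h : IsLower M) :
    lowerMatrix (lowerPart M) = M := by
  have h0 : upperPart M = 0 := by
    ext (p | p) <;> simp [upperPart, h p.2]
  simpa [h0] using upperMatrix_add_lowerMatrix M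

theorem lowerMatrix_injective : Function.Injective (lowerMatrix (n := n)) := fun s t h => by
  rw [← lowerPart_lowerMatrix s, h, lowerPart_lowerMatrix]

theorem IsLower.isLowerTriangular {M : Matrix (Fin n) (Fin n) ℂ} (h : IsLower M) :
    M.BlockTriangular OrderDual.toDual := fun _ _ hjk => h hjk

theorem IsLower.mul {M N : Matrix (Fin n) (Fin n) ℂ} (hM : IsLower M) (hN : IsLower N) :
    IsLower (M * N) := fun _ _ h =>
  (hM.isLowerTriangular.mul hN.isLowerTriangular) h

theorem IsLower.det_eq {M : Matrix (Fin n) (Fin n) ℂ} (h : IsLower M) :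
    M.det = ∏ j, M j j := Matrix.det_of_isLowerTriangular M h.isLowerTriangular

theorem IsLower.inv {M : Matrix (Fin n) (Fin n) ℂ} (hM : IsLower M) (h : IsUnit M.det) :
    IsLower M⁻¹ := by
  have := Matrix.invertibleOfIsUnitDet M h
  intro j k hjk
  exact Matrix.blockTriangular_inv_of_blockTriangular hM.isLowerTriangular hjk

theorem isUnit_det_lowerMatrix {t : LowerCoord n} (h : ∀ j, t.1 j ≠ 0) :
    IsUnit (lowerMatrix t).det := by
  rw [(isLower_lowerMatrix t).det_eq, isUnit_iff_ne_zero, Finset.prod_ne_zero_iff]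
  intro j _
  rw [lowerMatrix_diag]
  exact h j

/-- A lower triangular unitary matrix is diagonal with entries of modulus one. -/
theorem IsLower.diag_of_unitary {M : Matrix (Fin n) (Fin n) ℂ} (h : IsLower M)
    (hM : M * M.conjTranspose = 1) : (∀ j k, j ≠ k → M j k = 0) ∧ ∀ j, ‖M j j‖ = 1 := by
  have hu : IsUnit M.det := Matrix.isUnit_det_of_right_inverse hM
  -- The inverse is lower triangular as an inverse and upper triangular as a conjugate transpose, so
  -- `M` is diagonal.
  have hinv : M⁻¹ = M.conjTranspose := Matrix.inv_eq_right_inv hM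
  have hlow := h.inv hu
  rw [hinv] at hlow
  have hd : ∀ j k, j ≠ k → M j k = 0 := by
    intro j k hjk
    rcases lt_or_gt_of_ne hjk with hlt | hlt
    · exact h hlt
    · have := hlow hlt
      simpa [Matrix.conjTranspose_apply] using this
  refine ⟨hd, fun j => ?_⟩
  have h1 := congrFun (congrFun hM j) j
  rw [Matrix.mul_apply, Finset.sum_eq_single j (fun l _ hl => by simp [hd j l hl.symm])
    (by simp)] at h1
  simp only [Matrix.conjTranspose_apply, Matrix.one_apply_eq] at h1
  have h2 := congrArg norm h1
  simp only [norm_mul, norm_star, norm_one] at h2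
  nlinarith [norm_nonneg (M j j)]

/-- Matrices with positive diagonal. -/
def posDiag (n : ℕ) : Set (Matrix (Fin n) (Fin n) ℂ) := {U | ∀ j, 0 < (U j j).re}

theorem realDiagUnitary.mul_star {U : Matrix (Fin n) (Fin n) ℂ} (hU : U ∈ realDiagUnitary n) :
    U * U.conjTranspose = 1 := Matrix.mem_unitaryGroup_iff.1 hU.1

theorem realDiagUnitary.star_mul {U : Matrix (Fin n) (Fin n) ℂ} (hU : U ∈ realDiagUnitary n) :
    U.conjTranspose * U = 1 := Matrix.mem_unitaryGroup_iff'.1 hU.1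

/-- Uniqueness of the factorization `Z = T U` with `T` lower triangular and `U` unitary with
positive diagonal. -/
theorem lower_mul_unitary_unique {S T U V : Matrix (Fin n) (Fin n) ℂ} (hS : IsLower S)
    (hT : IsLower T) (hTu : IsUnit T.det)
    (hU : U ∈ realDiagUnitary n) (hV : V ∈ realDiagUnitary n) (hU' : U ∈ posDiag n)
    (hV' : V ∈ posDiag n) (h : S * U = T * V) : S = T ∧ U = V := by
  have hM : V = T⁻¹ * S * U := by
    rw [Matrix.mul_assoc, h, ← Matrix.mul_assoc, Matrix.nonsing_inv_mul _ hTu, Matrix.one_mul]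
  -- `M = T⁻¹ S = V U*` is both lower triangular and unitary, hence diagonal with entries of modulus
  -- one; the positive diagonals of `U` and `V` then force `M = 1`.
  set M := T⁻¹ * S with hMdef
  have hMl : IsLower M := (hT.inv hTu).mul hS
  have hMV : M = V * U.conjTranspose := by
    rw [hM, Matrix.mul_assoc, realDiagUnitary.mul_star hU, Matrix.mul_one]
  have hMu : M * M.conjTranspose = 1 := by
    rw [hMV, Matrix.conjTranspose_mul, Matrix.conjTranspose_conjTranspose, Matrix.mul_assoc,
      ← Matrix.mul_assoc U.conjTranspose, realDiagUnitary.star_mul hU, Matrix.one_mul,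
      realDiagUnitary.mul_star hV]
  obtain ⟨hd, hn⟩ := hMl.diag_of_unitary hMu
  have hM1 : M = 1 := by
    ext j k
    by_cases hjk : j = k
    · subst hjk
      have h1 : V j j = M j j * U j j := by
        conv_lhs => rw [hM]
        rw [Matrix.mul_apply, Finset.sum_eq_single j
          (fun l _ hl => by simp [hd j l hl.symm]) (by simp)]
      have hUj : U j j = ((U j j).re : ℂ) := by
        apply Complex.ext <;> simp [(hU.2 j).1]
      have hVj : V j j = ((V j j).re : ℂ) := by
        apply Complex.ext <;> simp [(hV.2 j).1]
      have hn' : ‖V j j‖ = ‖U j j‖ := by rw [h1, norm_mul, hn j, one_mul]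
      rw [hUj, hVj, Complex.norm_of_nonneg (hV' j).le, Complex.norm_of_nonneg (hU' j).le] at hn'
      rw [hUj, hVj, hn'] at h1
      have h0 : ((U j j).re : ℂ) ≠ 0 := by exact_mod_cast (hU' j).ne'
      rw [Matrix.one_apply_eq]
      exact (mul_right_cancel₀ h0 (by rw [one_mul]; exact h1)).symm
    · rw [hd j k hjk, Matrix.one_apply_ne hjk]
  refine ⟨?_, by rw [hM, hM1, Matrix.one_mul]⟩
  have : T * M = S := by
    rw [hMdef, ← Matrix.mul_assoc, Matrix.mul_nonsing_inv _ hTu, Matrix.one_mul]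
  rw [← this, hM1, Matrix.mul_one]

/-! ### Determinants -/

/-- The matrix is block lower triangular with an identity block for `Y`. This is what makes the
`T`-directions contribute the factor one to the Jacobian. -/
theorem det_prod_shear {X Y : Type*} [AddCommGroup X] [Module ℝ X] [AddCommGroup Y] [Module ℝ Y]
    [Module.Finite ℝ X] [Module.Finite ℝ Y] (A : X →ₗ[ℝ] X) (S : X →ₗ[ℝ] Y) :
    ((A ∘ₗ LinearMap.fst ℝ X Y).prod
      (LinearMap.snd ℝ X Y + S ∘ₗ LinearMap.fst ℝ X Y)).det = A.det := by
  classical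
  let b := Module.finBasis ℝ X
  let c := Module.finBasis ℝ Y
  have h : LinearMap.toMatrix (b.prod c) (b.prod c) ((A ∘ₗ LinearMap.fst ℝ X Y).prod
      (LinearMap.snd ℝ X Y + S ∘ₗ LinearMap.fst ℝ X Y)) =
      Matrix.fromBlocks (LinearMap.toMatrix b b A) 0 (LinearMap.toMatrix b c S) 1 := by
    ext (i | i) (j | j) <;> simp [LinearMap.toMatrix_apply, Matrix.one_apply,
      Finsupp.single_apply, eq_comm]
  rw [← LinearMap.det_toMatrix (b.prod c), h, Matrix.det_fromBlocks_zero₁₂, Matrix.det_one,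
    mul_one, LinearMap.det_toMatrix]

/-- Complex coordinates on strictly upper triangular matrices. -/
def pairEquiv (n : ℕ) : (UpperPair n → ℂ) ≃ₗ[ℝ] UpperCoord n where
  toFun y := Sum.elim (fun p => (y p).re) (fun p => (y p).im)
  invFun x p := ⟨x (Sum.inl p), x (Sum.inr p)⟩
  map_add' y z := by ext (p | p) <;> simp
  map_smul' c y := by ext (p | p) <;> simp
  left_inv y := rfl
  right_inv x := by ext (p | p) <;> rfl

theorem upperMatrix_pairEquiv_apply (y : UpperPair n → ℂ) (j k : Fin n) :
    upperMatrix (pairEquiv n y) j k = if h : j < k then y ⟨(j, k), h⟩ else 0 := by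
  simp only [upperMatrix, pairEquiv, LinearMap.coe_mk, AddHom.coe_mk, Matrix.of_apply]
  rfl

/-- Left multiplication by a matrix on the entries above the diagonal. -/
def upperMul (T : Matrix (Fin n) (Fin n) ℂ) : UpperCoord n →ₗ[ℝ] UpperCoord n :=
  upperPart ∘ₗ LinearMap.mulLeft ℝ T ∘ₗ upperMatrix

theorem sum_upperPair {A : Type*} [AddCommMonoid A] (f : UpperPair n → A) :
    ∑ q, f q = ∑ l, ∑ m, if h : l < m then f ⟨(l, m), h⟩ else 0 := by
  rw [← Fintype.sum_prod_type' (f := fun l m => if h : l < m then f ⟨(l, m), h⟩ else 0)]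
  rw [← Finset.sum_filter_add_sum_filter_not Finset.univ (fun p : Fin n × Fin n => p.1 < p.2)]
  rw [Finset.sum_eq_zero (s := Finset.univ.filter fun p : Fin n × Fin n => ¬ p.1 < p.2), add_zero]
  · rw [Finset.sum_subtype _ (p := fun p : Fin n × Fin n => p.1 < p.2) (by simp)]
    exact Finset.sum_congr rfl fun q _ => by rw [dif_pos q.2]
  · intro p hp
    rw [Finset.mem_filter] at hp
    rw [dif_neg hp.2]

/-- The matrix of `upperMul` in complex coordinates. -/
def upperMulMatrix (T : Matrix (Fin n) (Fin n) ℂ) : Matrix (UpperPair n) (UpperPair n) ℂ :=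
  Matrix.of fun p q => if p.1.2 = q.1.2 then T p.1.1 q.1.1 else 0

/-- Left multiplication acts on each column separately, so only pairs with the same second index are
coupled. -/
theorem upperMul_pairEquiv (T : Matrix (Fin n) (Fin n) ℂ) (y : UpperPair n → ℂ) :
    upperMul T (pairEquiv n y) = pairEquiv n ((upperMulMatrix T).mulVec y) := by
  have key : ∀ p : UpperPair n, (T * upperMatrix (pairEquiv n y)) p.1.1 p.1.2 =
      (upperMulMatrix T).mulVec y p := by
    intro p
    rw [Matrix.mul_apply, Matrix.mulVec, dotProduct, sum_upperPair]
    refine Finset.sum_congr rfl fun l _ => ?_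
    rw [Finset.sum_eq_single p.1.2, upperMatrix_pairEquiv_apply]
    · simp [upperMulMatrix]
    · intro m _ hm
      simp [upperMulMatrix, hm.symm]
    · simp
  ext (p | p)
  · exact congrArg Complex.re (key p)
  · exact congrArg Complex.im (key p)

/-- This count is the multiplicity with which `T a a` occurs in `det_upperMulMatrix`. -/
theorem card_upperPair_row (a : Fin n) :
    Fintype.card {p : UpperPair n // OrderDual.toDual p.1.1 = OrderDual.toDual a} =
      n - 1 - a := by
  have e : {p : UpperPair n // OrderDual.toDual p.1.1 = OrderDual.toDual a} ≃
      {k : Fin n // a < k} :=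
    { toFun := fun p => ⟨p.1.1.2, by
        have h1 := p.2
        have h2 := p.1.2
        rw [OrderDual.toDual_inj] at h1
        rwa [h1] at h2⟩
      invFun := fun k => ⟨⟨(a, k.1), k.2⟩, rfl⟩
      left_inv := by
        rintro ⟨⟨⟨j, k⟩, h⟩, h'⟩
        obtain rfl : j = a := by simpa using h'
        rfl
      right_inv := fun k => rfl }
  rw [Fintype.card_congr e, Fintype.card_subtype, Finset.filter_lt_eq_Ioi, Fin.card_Ioi]

/-- Grouping the pairs by row index makes the matrix block triangular, and the block of row `a` is
the scalar `T a a`. -/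
theorem det_upperMulMatrix {T : Matrix (Fin n) (Fin n) ℂ} (hT : IsLower T) :
    (upperMulMatrix T).det = ∏ j : Fin n, T j j ^ (n - 1 - (j : ℕ)) := by
  have h : (upperMulMatrix T).BlockTriangular
      (fun p : UpperPair n => OrderDual.toDual p.1.1) := by
    intro p q hpq
    have : p.1.1 < q.1.1 := hpq
    simp [upperMulMatrix, hT this]
  rw [h.det_fintype, ← Equiv.prod_comp OrderDual.toDual]
  refine Finset.prod_congr rfl fun a _ => ?_
  have hb : (upperMulMatrix T).toSquareBlock (fun p : UpperPair n => OrderDual.toDual p.1.1)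
      (OrderDual.toDual a) = Matrix.diagonal fun _ => T a a := by
    ext ⟨⟨⟨j, k⟩, hjk⟩, hj⟩ ⟨⟨⟨j', k'⟩, hjk'⟩, hj'⟩
    obtain rfl : j = a := by simpa using hj
    obtain rfl : j' = j := by simpa using hj'
    by_cases hk : k = k'
    · subst hk
      simp [Matrix.toSquareBlock, Matrix.toSquareBlockProp, upperMulMatrix]
    · simp [Matrix.toSquareBlock, Matrix.toSquareBlockProp, upperMulMatrix, hk,
        Matrix.diagonal]
  rw [hb, Matrix.det_diagonal, Finset.prod_const, Finset.card_univ, card_upperPair_row]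

/-- The real determinant of a complex linear map is the squared modulus of its complex determinant,
which doubles the exponents. -/
theorem det_upperMul {T : Matrix (Fin n) (Fin n) ℂ} (hT : IsLower T) :
    (upperMul T).det = ∏ j : Fin n, ‖T j j‖ ^ (2 * (n - 1 - (j : ℕ))) := by
  have h : upperMul T = (pairEquiv n).toLinearMap ∘ₗ
      ((Matrix.toLin' (upperMulMatrix T)).restrictScalars ℝ) ∘ₗ (pairEquiv n).symm.toLinearMap := by
    refine LinearMap.ext fun x => ?_
    obtain ⟨y, rfl⟩ := (pairEquiv n).surjective x
    simp [upperMul_pairEquiv]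
  rw [h, LinearMap.det_conj, LinearMap.det_restrictScalars, LinearMap.det_toLin',
    det_upperMulMatrix hT, Algebra.norm_complex_apply, map_prod]
  refine Finset.prod_congr rfl fun j _ => ?_
  rw [map_pow, Complex.normSq_eq_norm_sq, ← pow_mul]

/-- `T` maps lower triangular matrices to lower triangular ones, so it acts on the quotient by them.
Hence only the entries of `dG₁` above the diagonal enter the Jacobian. -/
theorem upperPart_lower_mul {T : Matrix (Fin n) (Fin n) ℂ} (hT : IsLower T)
    (M : Matrix (Fin n) (Fin n) ℂ) : upperPart (T * M) = upperMul T (upperPart M) := by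
  have h0 : upperPart (T * lowerMatrix (lowerPart M)) = 0 := by
    rw [← (hT.mul (isLower_lowerMatrix _)).eq_lowerMatrix, upperPart_lowerMatrix]
  conv_lhs => rw [← upperMatrix_add_lowerMatrix M, Matrix.mul_add, map_add, h0, add_zero]
  rfl

theorem dGForm_apply (i : UpperPair n ⊕ UpperPair n) (U A : Matrix (Fin n) (Fin n) ℂ) :
    dGForm n i U A = upperPart (A * U.conjTranspose) i := by
  rcases i with p | p <;> rfl

/-- The linear map `(dx, t) ↦ t + T · P dx · U*` in coordinates. -/
def frameMap (T U : Matrix (Fin n) (Fin n) ℂ)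
    (P : UpperCoord n →ₗ[ℝ] Matrix (Fin n) (Fin n) ℂ) :
    UpperCoord n × LowerCoord n →ₗ[ℝ] UpperCoord n × LowerCoord n :=
  (coordEquiv n).toLinearMap ∘ₗ (lowerMatrix ∘ₗ LinearMap.snd ℝ _ _ +
    LinearMap.mulLeft ℝ T ∘ₗ LinearMap.mulRight ℝ U.conjTranspose ∘ₗ P ∘ₗ LinearMap.fst ℝ _ _)

/-- The component above the diagonal depends on `dx` only, through `upperMul T` composed with the
matrix of the form; the remaining component is the identity in `t` plus a shear. -/
theorem det_frameMap {T : Matrix (Fin n) (Fin n) ℂ} (hT : IsLower T)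
    (U : Matrix (Fin n) (Fin n) ℂ) (P : UpperCoord n →ₗ[ℝ] Matrix (Fin n) (Fin n) ℂ) :
    (frameMap T U P).det = (∏ j : Fin n, ‖T j j‖ ^ (2 * (n - 1 - (j : ℕ)))) *
      (Matrix.of fun i k => dGForm n i U (P (Pi.single k 1))).det := by
  set B : Matrix (UpperPair n ⊕ UpperPair n) (UpperPair n ⊕ UpperPair n) ℝ :=
    Matrix.of fun i k => dGForm n i U (P (Pi.single k 1)) with hB
  have hBP : Matrix.toLin' B = upperPart ∘ₗ LinearMap.mulRight ℝ U.conjTranspose ∘ₗ P := by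
    apply LinearMap.toMatrix'.injective
    rw [LinearMap.toMatrix'_toLin']
    ext i k
    rw [LinearMap.toMatrix'_apply, hB, Matrix.of_apply, dGForm_apply]
    simp
  have h : frameMap T U P = ((upperMul T ∘ₗ Matrix.toLin' B) ∘ₗ LinearMap.fst ℝ _ _).prod
      (LinearMap.snd ℝ _ _ + (lowerPart ∘ₗ LinearMap.mulLeft ℝ T ∘ₗ
        LinearMap.mulRight ℝ U.conjTranspose ∘ₗ P) ∘ₗ LinearMap.fst ℝ _ _) := by
    rw [hBP]
    refine LinearMap.ext fun w => Prod.ext ?_ ?_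
    · simp [frameMap, coordEquiv_apply, upperPart_lowerMatrix, upperPart_lower_mul hT]
    · simp [frameMap, coordEquiv_apply, lowerPart_lowerMatrix]
  rw [h, det_prod_shear, LinearMap.det_comp, det_upperMul hT, LinearMap.det_toLin']

/-! ### Gaussian integrals -/

instance borelSpace_lowerCoord : BorelSpace (LowerCoord n) := Prod.borelSpace

instance secondCountable_lowerCoord : SecondCountableTopology (LowerCoord n) :=
  TopologicalSpace.instSecondCountableTopologyProd

instance borelSpace_coord : BorelSpace (UpperCoord n × LowerCoord n) := Prod.borelSpace

instance isAddHaar_lowerCoord : (volume : Measure (LowerCoord n)).IsAddHaarMeasure :=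
  Measure.prod.instIsAddHaarMeasure (volume : Measure (Fin n → ℂ))
    (volume : Measure (UpperPair n → ℂ))

instance isAddHaar_coord : (volume : Measure (UpperCoord n × LowerCoord n)).IsAddHaarMeasure :=
  Measure.prod.instIsAddHaarMeasure (volume : Measure (UpperCoord n))
    (volume : Measure (LowerCoord n))

theorem lintegral_pi_prod_ofReal {ι E : Type*} [Fintype ι] [MeasureSpace E]
    [SigmaFinite (volume : Measure E)] (g : ι → E → ℝ) (h0 : ∀ i x, 0 ≤ g i x)
    (hg : ∀ i, Integrable (g i)) :
    ∫⁻ x : ι → E, ENNReal.ofReal (∏ i, g i (x i)) = ENNReal.ofReal (∏ i, ∫ y, g i y) := by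
  rw [← integral_fintype_prod_volume_eq_prod, ofReal_integral_eq_lintegral_ofReal]
  · exact Integrable.fintype_prod hg
  · exact Filter.Eventually.of_forall fun x => Finset.prod_nonneg fun i _ => h0 i _

theorem integral_complex_pow_mul_gaussian (m : ℕ) :
    ∫ z : ℂ, ‖z‖ ^ (2 * m) * Real.exp (-‖z‖ ^ 2) = Real.pi * m.factorial := by
  have h := Complex.integral_rpow_mul_exp_neg_rpow (p := 2) (q := ((2 * m : ℕ) : ℝ)) (by norm_num)
    (by have : (0 : ℝ) ≤ ((2 * m : ℕ) : ℝ) := by positivity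
        linarith)
  simp only [Real.rpow_natCast, Real.rpow_ofNat] at h
  rw [h]
  have : (((2 * m : ℕ) : ℝ) + 2) / 2 = m + 1 := by push_cast; ring
  rw [this, Real.Gamma_nat_eq_factorial]
  ring

theorem integrable_complex_pow_mul_gaussian (m : ℕ) :
    Integrable fun z : ℂ => ‖z‖ ^ (2 * m) * Real.exp (-‖z‖ ^ 2) := by
  -- The Bochner integral of a non-integrable function is zero, so a nonzero value proves
  -- integrability.
  refine Integrable.of_integral_ne_zero ?_
  rw [integral_complex_pow_mul_gaussian]
  have := Real.pi_pos
  positivity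

theorem integral_complex_gaussian : ∫ z : ℂ, Real.exp (-‖z‖ ^ 2) = Real.pi := by
  simpa using integral_complex_pow_mul_gaussian 0

theorem integrable_complex_gaussian : Integrable fun z : ℂ => Real.exp (-‖z‖ ^ 2) := by
  simpa using integrable_complex_pow_mul_gaussian 0

/-- The square of the Frobenius norm. -/
def frobSq (M : Matrix (Fin n) (Fin n) ℂ) : ℝ := ∑ j, ∑ k, ‖M j k‖ ^ 2

theorem frobSq_eq_trace (M : Matrix (Fin n) (Fin n) ℂ) :
    ((frobSq M : ℝ) : ℂ) = (M * M.conjTranspose).trace := by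
  simp only [frobSq, Matrix.trace, Matrix.diag, Matrix.mul_apply, Matrix.conjTranspose_apply]
  push_cast
  refine Finset.sum_congr rfl fun j _ => Finset.sum_congr rfl fun k _ => ?_
  rw [← Complex.mul_conj']
  rfl

theorem frobSq_mul_unitary (M : Matrix (Fin n) (Fin n) ℂ) {V : Matrix (Fin n) (Fin n) ℂ}
    (hV : V * V.conjTranspose = 1) : frobSq (M * V) = frobSq M := by
  have h : ((frobSq (M * V) : ℝ) : ℂ) = (frobSq M : ℝ) := by
    rw [frobSq_eq_trace, frobSq_eq_trace, Matrix.conjTranspose_mul, Matrix.mul_assoc,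
      ← Matrix.mul_assoc V, hV, Matrix.one_mul]
  exact_mod_cast h

theorem frobSq_eq_sum (M : Matrix (Fin n) (Fin n) ℂ) :
    frobSq M = ∑ i, upperPart M i ^ 2 +
      (∑ j, ‖M j j‖ ^ 2 + ∑ p : UpperPair n, ‖M p.1.2 p.1.1‖ ^ 2) := by
  have h1 : ∑ i, upperPart M i ^ 2 = ∑ p : UpperPair n, ‖M p.1.1 p.1.2‖ ^ 2 := by
    rw [Fintype.sum_sum_type, ← Finset.sum_add_distrib]
    refine Finset.sum_congr rfl fun p _ => ?_
    rw [← Complex.normSq_eq_norm_sq, Complex.normSq_apply]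
    simp only [upperPart, LinearMap.coe_mk, AddHom.coe_mk, Sum.elim_inl, Sum.elim_inr]
    ring
  have h2 : ∑ j, ‖M j j‖ ^ 2 = ∑ j, ∑ k, if j = k then ‖M j k‖ ^ 2 else 0 := by simp
  rw [h1, sum_upperPair, sum_upperPair (fun p : UpperPair n => ‖M p.1.2 p.1.1‖ ^ 2),
    Finset.sum_comm (f := fun l m => if h : l < m then
      ‖M (⟨(l, m), h⟩ : UpperPair n).1.2 (⟨(l, m), h⟩ : UpperPair n).1.1‖ ^ 2 else 0), h2]
  simp only [frobSq, ← Finset.sum_add_distrib]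
  refine Finset.sum_congr rfl fun j _ => Finset.sum_congr rfl fun k _ => ?_
  rcases lt_trichotomy j k with h | rfl | h
  · simp [h, h.ne, h.le]
  · simp
  · simp [h, h.ne', h.le]

/-- The Gaussian density on the space of matrices. -/
def gauss (M : Matrix (Fin n) (Fin n) ℂ) : ℝ≥0∞ := ENNReal.ofReal (Real.exp (-frobSq M))

theorem gauss_coordEquiv_symm (x : UpperCoord n) (t : LowerCoord n) :
    gauss ((coordEquiv n).symm (x, t)) = ENNReal.ofReal (∏ i, Real.exp (-x i ^ 2)) *
      (ENNReal.ofReal (∏ j, Real.exp (-‖t.1 j‖ ^ 2)) *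
        ENNReal.ofReal (∏ p, Real.exp (-‖t.2 p‖ ^ 2))) := by
  have hx : upperPart ((coordEquiv n).symm (x, t)) = x :=
    congrArg Prod.fst ((coordEquiv n).apply_symm_apply (x, t))
  have ht : lowerPart ((coordEquiv n).symm (x, t)) = t :=
    congrArg Prod.snd ((coordEquiv n).apply_symm_apply (x, t))
  set M : Matrix (Fin n) (Fin n) ℂ := (coordEquiv n).symm (x, t)
  have h1 : ∀ j, M j j = t.1 j := fun j => by rw [← ht]; rfl
  have h2 : ∀ p : UpperPair n, M p.1.2 p.1.1 = t.2 p := fun p => by rw [← ht]; rfl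
  rw [gauss, frobSq_eq_sum, hx]
  simp only [h1, h2]
  rw [← ENNReal.ofReal_mul (by positivity), ← ENNReal.ofReal_mul (by positivity),
    ← Real.exp_sum, ← Real.exp_sum, ← Real.exp_sum, ← Real.exp_add, ← Real.exp_add]
  simp only [Finset.sum_neg_distrib]
  congr 2
  ring

theorem gauss_lowerMatrix (t : LowerCoord n) :
    gauss (lowerMatrix t) = ENNReal.ofReal (∏ j, Real.exp (-‖t.1 j‖ ^ 2)) *
        ENNReal.ofReal (∏ p, Real.exp (-‖t.2 p‖ ^ 2)) := by
  have h := gauss_coordEquiv_symm 0 t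
  rw [coordEquiv_symm_apply] at h
  simpa using h

/-- Each real coordinate above the diagonal gives `√π` and each complex coordinate on or below it
gives `π`. -/
theorem lintegral_gauss : ∫⁻ w, gauss ((coordEquiv n).symm w) =
    ENNReal.ofReal (Real.pi ^ (2 * Fintype.card (UpperPair n) + n)) := by
  have h : ∀ w : UpperCoord n × LowerCoord n, gauss ((coordEquiv n).symm w) =
      ENNReal.ofReal (∏ i, Real.exp (-w.1 i ^ 2)) *
      (ENNReal.ofReal (∏ j, Real.exp (-‖w.2.1 j‖ ^ 2)) *
        ENNReal.ofReal (∏ p, Real.exp (-‖w.2.2 p‖ ^ 2))) := fun w => gauss_coordEquiv_symm _ _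
  simp_rw [h]
  rw [Measure.volume_eq_prod, lintegral_prod_mul
      (f := fun x : UpperCoord n => ENNReal.ofReal (∏ i, Real.exp (-x i ^ 2)))
      (g := fun t : LowerCoord n => ENNReal.ofReal (∏ j, Real.exp (-‖t.1 j‖ ^ 2)) *
        ENNReal.ofReal (∏ p, Real.exp (-‖t.2 p‖ ^ 2))) (Measurable.aemeasurable (by fun_prop))
      (Measurable.aemeasurable (by fun_prop)),
    Measure.volume_eq_prod, lintegral_prod_mul
      (f := fun x : Fin n → ℂ => ENNReal.ofReal (∏ j, Real.exp (-‖x j‖ ^ 2)))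
      (g := fun z : UpperPair n → ℂ => ENNReal.ofReal (∏ p, Real.exp (-‖z p‖ ^ 2)))
      (Measurable.aemeasurable (by fun_prop))
      (Measurable.aemeasurable (by fun_prop)),
    lintegral_pi_prod_ofReal (fun _ (x : ℝ) => Real.exp (-x ^ 2)) (fun _ _ => by positivity)
      (fun _ => by simpa using integrable_exp_neg_mul_sq one_pos),
    lintegral_pi_prod_ofReal (fun _ (x : ℂ) => Real.exp (-‖x‖ ^ 2)) (fun _ _ => by positivity)
      (fun _ => integrable_complex_gaussian),
    lintegral_pi_prod_ofReal (fun _ (x : ℂ) => Real.exp (-‖x‖ ^ 2)) (fun _ _ => by positivity)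
      (fun _ => integrable_complex_gaussian)]
  have hr : ∫ x : ℝ, Real.exp (-x ^ 2) = √Real.pi := by simpa using integral_gaussian 1
  have hpi := Real.pi_pos
  simp only [hr, integral_complex_gaussian, Finset.prod_const, Finset.card_univ, Fintype.card_sum,
    Fintype.card_fin]
  rw [← ENNReal.ofReal_mul (by positivity), ← ENNReal.ofReal_mul (by positivity), ← two_mul,
    pow_mul, Real.sq_sqrt hpi.le]
  congr 1
  ring

/-- The Jacobian factor coming from the triangular matrix. -/
def lowerWeight (t : LowerCoord n) : ℝ≥0∞ :=
  ENNReal.ofReal (∏ j : Fin n, ‖t.1 j‖ ^ (2 * (n - 1 - (j : ℕ))))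

/-- Coordinates of the invertible lower triangular matrices. -/
def lowerUnits (n : ℕ) : Set (LowerCoord n) := {t | ∀ j, t.1 j ≠ 0}

theorem isOpen_lowerUnits : IsOpen (lowerUnits n) := by
  rw [lowerUnits, Set.ofPred_forall]
  exact isOpen_iInter_of_finite fun j =>
    isOpen_ne_fun (by fun_prop) continuous_const

/-- The complement is a finite union of proper real subspaces. -/
theorem volume_compl_lowerUnits : volume (lowerUnits n)ᶜ = 0 := by
  have h : (lowerUnits n)ᶜ = ⋃ j, (LinearMap.ker ((LinearMap.proj j : (Fin n → ℂ) →ₗ[ℝ] ℂ) ∘ₗ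
      LinearMap.fst ℝ (Fin n → ℂ) (UpperPair n → ℂ)) : Set (LowerCoord n)) := by
    ext t
    simp [lowerUnits]
  rw [h, measure_iUnion_null_iff]
  intro j
  refine Measure.addHaar_submodule _ _ fun htop => ?_
  have : ((fun _ => 1, 0) : LowerCoord n) ∈ LinearMap.ker
      ((LinearMap.proj j : (Fin n → ℂ) →ₗ[ℝ] ℂ) ∘ₗ
        LinearMap.fst ℝ (Fin n → ℂ) (UpperPair n → ℂ)) := htop ▸ Submodule.mem_top
  simp at this

theorem measurable_lowerWeight : Measurable (lowerWeight (n := n)) := by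
  unfold lowerWeight
  fun_prop

theorem measurable_gauss_lowerMatrix :
    Measurable fun t : LowerCoord n => gauss (lowerMatrix t) := by
  simp_rw [gauss_lowerMatrix]
  fun_prop

/-- The Jacobian turns the integral over the diagonal entry `j` into the Gaussian moment `π
(n-1-j)!`; each entry below the diagonal gives `π`. -/
theorem lintegral_lowerWeight :
    ∫⁻ t in lowerUnits n, lowerWeight t * gauss (lowerMatrix t) =
      ENNReal.ofReal (Real.pi ^ (n + Fintype.card (UpperPair n)) *
        ∏ j : Fin n, ((n - 1 - (j : ℕ)).factorial : ℝ)) := by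
  have hae : (lowerUnits n : Set (LowerCoord n)) =ᵐ[volume] Set.univ :=
    ae_eq_univ.2 volume_compl_lowerUnits
  rw [setLIntegral_congr hae, setLIntegral_univ]
  have h : ∀ t : LowerCoord n, lowerWeight t * gauss (lowerMatrix t) =
      ENNReal.ofReal (∏ j : Fin n, ‖t.1 j‖ ^ (2 * (n - 1 - (j : ℕ))) * Real.exp (-‖t.1 j‖ ^ 2)) *
        ENNReal.ofReal (∏ p, Real.exp (-‖t.2 p‖ ^ 2)) := fun t => by
    rw [gauss_lowerMatrix, lowerWeight, ← mul_assoc, ← ENNReal.ofReal_mul (by positivity),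
      Finset.prod_mul_distrib]
  simp_rw [h]
  rw [Measure.volume_eq_prod, lintegral_prod_mul
      (f := fun x : Fin n → ℂ => ENNReal.ofReal
        (∏ j : Fin n, ‖x j‖ ^ (2 * (n - 1 - (j : ℕ))) * Real.exp (-‖x j‖ ^ 2)))
      (g := fun z : UpperPair n → ℂ => ENNReal.ofReal (∏ p, Real.exp (-‖z p‖ ^ 2)))
      (Measurable.aemeasurable (by fun_prop))
      (Measurable.aemeasurable (by fun_prop)),
    lintegral_pi_prod_ofReal (fun (j : Fin n) (x : ℂ) =>
      ‖x‖ ^ (2 * (n - 1 - (j : ℕ))) * Real.exp (-‖x‖ ^ 2)) (fun _ _ => by positivity)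
      (fun _ => integrable_complex_pow_mul_gaussian _),
    lintegral_pi_prod_ofReal (fun _ (x : ℂ) => Real.exp (-‖x‖ ^ 2)) (fun _ _ => by positivity)
      (fun _ => integrable_complex_gaussian)]
  have hpi := Real.pi_pos
  simp only [integral_complex_pow_mul_gaussian, integral_complex_gaussian, Finset.prod_const,
    Finset.card_univ, Fintype.card_fin, Finset.prod_mul_distrib]
  rw [← ENNReal.ofReal_mul (by positivity)]
  congr 1
  ring

/-- Right multiplication by a unitary matrix preserves volume. -/
theorem abs_det_mulRight_unitary {V : Matrix (Fin n) (Fin n) ℂ} (hV : V * V.conjTranspose = 1) :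
    |((coordEquiv n).toLinearMap ∘ₗ LinearMap.mulRight ℝ V ∘ₗ
      (coordEquiv n).symm.toLinearMap).det| = 1 := by
  set f := (coordEquiv n).toLinearMap ∘ₗ LinearMap.mulRight ℝ V ∘ₗ
      (coordEquiv n).symm.toLinearMap with hf
  have hfa : ∀ w, f w = coordEquiv n ((coordEquiv n).symm w * V) := fun w => rfl
  have hVinv : V.conjTranspose * V = 1 := mul_eq_one_comm.1 hV
  have hbij : Function.Bijective f := by
    refine Function.bijective_iff_has_inverse.2
      ⟨fun w => coordEquiv n ((coordEquiv n).symm w * V.conjTranspose), fun w => ?_, fun w => ?_⟩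
    · simp [hfa, Matrix.mul_assoc, hV]
    · simp [hfa, Matrix.mul_assoc, hVinv]
  let f' : (UpperCoord n × LowerCoord n) →L[ℝ] (UpperCoord n × LowerCoord n) :=
    LinearMap.toContinuousLinearMap f
  -- The Gaussian is invariant under the map and has finite nonzero integral, so the change of
  -- variables formula leaves no value but one for `|det|`.
  have h := lintegral_image_eq_lintegral_abs_det_fderiv_mul
    (volume : Measure (UpperCoord n × LowerCoord n))
    MeasurableSet.univ (f := f) (f' := fun _ => f')
    (fun x _ => f'.hasFDerivWithinAt) hbij.injective.injOn
    (fun w => gauss ((coordEquiv n).symm w))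
  have hg : ∀ w, gauss ((coordEquiv n).symm (f w)) = gauss ((coordEquiv n).symm w) := fun w => by
    rw [hfa, LinearEquiv.symm_apply_apply, gauss, frobSq_mul_unitary _ hV, gauss]
  have hI := lintegral_gauss (n := n)
  have hpi := Real.pi_pos
  rw [Set.image_univ, hbij.surjective.range_eq, Measure.restrict_univ] at h
  simp only [hg] at h
  rw [lintegral_const_mul' _ _ ENNReal.ofReal_ne_top, hI] at h
  rw [← ENNReal.ofReal_mul (abs_nonneg _), ENNReal.ofReal_eq_ofReal_iff (by positivity)
    (by positivity)] at h
  have hdet : f'.det = f.det := rfl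
  rw [hdet] at h
  have hp : (0 : ℝ) < Real.pi ^ (2 * Fintype.card (UpperPair n) + n) := by positivity
  exact (mul_right_cancel₀ hp.ne' (by rw [one_mul]; exact h)).symm

/-! ### The change of variables `Z = T U` -/

instance borelSpace_matrix : BorelSpace (Matrix (Fin n) (Fin n) ℂ) := ⟨rfl⟩

/-- The topology underlying the local norm is the one whose Borel sets were chosen; instance search
reaches it by this different path. -/
instance borelSpace_matrix_norm : @BorelSpace (Matrix (Fin n) (Fin n) ℂ)
    (@UniformSpace.toTopologicalSpace _ (@PseudoMetricSpace.toUniformSpace _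
      (@SeminormedAddCommGroup.toPseudoMetricSpace _
        (@NormedAddCommGroup.toSeminormedAddCommGroup _ Matrix.normedAddCommGroup))))
    (matrixMeasurableSpace n) := ⟨rfl⟩

/-- Parametrizations of pieces of `U₁(n)`. -/
abbrev UnitaryParam (n : ℕ) : Type := LocalParam (UpperPair n ⊕ UpperPair n) (realDiagUnitary n)

/-- The map `(x, t) ↦ T(t) · p(x)` in coordinates. -/
def lowerMulMap (f : UpperCoord n → Matrix (Fin n) (Fin n) ℂ)
    (w : UpperCoord n × LowerCoord n) : UpperCoord n × LowerCoord n :=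
  coordEquiv n (lowerMatrix w.2 * f w.1)

/-- The derivative of `lowerMulMap`. -/
def lowerMulDeriv (T U : Matrix (Fin n) (Fin n) ℂ)
    (P : UpperCoord n →ₗ[ℝ] Matrix (Fin n) (Fin n) ℂ) :
    UpperCoord n × LowerCoord n →ₗ[ℝ] UpperCoord n × LowerCoord n :=
  (coordEquiv n).toLinearMap ∘ₗ (LinearMap.mulRight ℝ U ∘ₗ lowerMatrix ∘ₗ LinearMap.snd ℝ _ _ +
    LinearMap.mulLeft ℝ T ∘ₗ P ∘ₗ LinearMap.fst ℝ _ _)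

/-- The derivative is the frame map followed by right multiplication by the unitary `U`, which
preserves volume. -/
theorem abs_det_lowerMulDeriv {T U : Matrix (Fin n) (Fin n) ℂ} (hT : IsLower T)
    (hU : U * U.conjTranspose = 1) (P : UpperCoord n →ₗ[ℝ] Matrix (Fin n) (Fin n) ℂ) :
    |(lowerMulDeriv T U P).det| = (∏ j : Fin n, ‖T j j‖ ^ (2 * (n - 1 - (j : ℕ)))) *
      |(Matrix.of fun i k => dGForm n i U (P (Pi.single k 1))).det| := by
  have hU' : U.conjTranspose * U = 1 := mul_eq_one_comm.1 hU
  have h : lowerMulDeriv T U P = ((coordEquiv n).toLinearMap ∘ₗ LinearMap.mulRight ℝ U ∘ₗ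
      (coordEquiv n).symm.toLinearMap) ∘ₗ frameMap T U P := by
    refine LinearMap.ext fun w => ?_
    simp [lowerMulDeriv, frameMap, Matrix.add_mul, Matrix.mul_assoc, hU']
  rw [h, LinearMap.det_comp, abs_mul, abs_det_mulRight_unitary hU, one_mul, det_frameMap hT,
    abs_mul, abs_of_nonneg (a := ∏ j : Fin n, ‖T j j‖ ^ (2 * (n - 1 - (j : ℕ))))]
  exact Finset.prod_nonneg fun j _ => by positivity

theorem hasFDerivAt_lowerMulMap {f : UpperCoord n → Matrix (Fin n) (Fin n) ℂ}
    {w : UpperCoord n × LowerCoord n} (hf : DifferentiableAt ℝ f w.1) :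
    HasFDerivAt (lowerMulMap f)
      (LinearMap.toContinuousLinearMap
        (lowerMulDeriv (lowerMatrix w.2) (f w.1) (fderiv ℝ f w.1).toLinearMap)) w := by
  let B := (LinearMap.mul ℝ (Matrix (Fin n) (Fin n) ℂ)).toContinuousBilinearMap
  have h1 : HasFDerivAt (fun w : UpperCoord n × LowerCoord n => lowerMatrix w.2)
      ((LinearMap.toContinuousLinearMap lowerMatrix).comp
        (ContinuousLinearMap.snd ℝ (UpperCoord n) (LowerCoord n))) w :=
    ((LinearMap.toContinuousLinearMap lowerMatrix).comp
      (ContinuousLinearMap.snd ℝ (UpperCoord n) (LowerCoord n))).hasFDerivAt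
  have h2 : HasFDerivAt (fun w : UpperCoord n × LowerCoord n => f w.1)
      ((fderiv ℝ f w.1).comp (ContinuousLinearMap.fst ℝ (UpperCoord n) (LowerCoord n))) w :=
    hf.hasFDerivAt.comp w hasFDerivAt_fst
  have h3 := B.hasFDerivAt_of_bilinear h1 h2
  have h4 := (LinearMap.toContinuousLinearMap (coordEquiv n).toLinearMap).hasFDerivAt.comp w h3
  refine h4.congr_fderiv ?_
  refine ContinuousLinearMap.ext fun v => ?_
  change coordEquiv n (lowerMatrix w.2 * fderiv ℝ f w.1 v.1 + lowerMatrix v.2 * f w.1) =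
    coordEquiv n (lowerMatrix v.2 * f w.1 + lowerMatrix w.2 * fderiv ℝ f w.1 v.1)
  rw [add_comm]

theorem LocalParam.measurableSet_preimage (p : UnitaryParam n)
    {E : Set (Matrix (Fin n) (Fin n) ℂ)} (hE : MeasurableSet E) :
    MeasurableSet (p.toFun ⁻¹' E ∩ p.domain) := by
  have h := (continuousOn_iff_continuous_domRestrict.1 p.contDiffOn.continuousOn).measurable hE
  have h2 := p.isOpen_domain.measurableSet.subtype_image h
  convert h2 using 1
  ext x
  simp [Set.domRestrict, and_comm]

theorem LocalParam.continuousOn_density (p : UnitaryParam n) :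
    ContinuousOn (p.density (dGForm n)) p.domain := by
  have hp := p.contDiffOn.continuousOn
  have hd := p.contDiffOn.continuousOn_fderiv_of_isOpen p.isOpen_domain le_rfl
  refine ContinuousOn.abs ?_
  have hentry : ∀ i k, ContinuousOn (fun x => dGForm n i (p.toFun x)
      (fderiv ℝ p.toFun x (Pi.single k 1))) p.domain := by
    intro i k
    simp only [dGForm_apply]
    have hc : Continuous fun A : Matrix (Fin n) (Fin n) ℂ => upperPart A i :=
      (continuous_apply i).comp (LinearMap.continuous_of_finiteDimensional upperPart)
    refine hc.comp_continuousOn ?_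
    refine ContinuousOn.mul (hd.clm_apply continuousOn_const) ?_
    exact (continuous_id.matrix_conjTranspose).comp_continuousOn hp
  exact (Continuous.matrix_det continuous_id).comp_continuousOn
    (continuousOn_pi.2 fun i => continuousOn_pi.2 fun k => hentry i k)

theorem LocalParam.measure_apply (p : UnitaryParam n)
    {E : Set (Matrix (Fin n) (Fin n) ℂ)} (hE : MeasurableSet E) :
    p.measure (dGForm n) E =
      ∫⁻ x in p.toFun ⁻¹' E ∩ p.domain, ENNReal.ofReal (p.density (dGForm n) x) := by
  have hm : AEMeasurable p.toFun (((volume : Measure (UpperCoord n)).restrict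
      p.domain).withDensity fun x => ENNReal.ofReal (p.density (dGForm n) x)) :=
    (p.contDiffOn.continuousOn.aemeasurable p.isOpen_domain.measurableSet).mono_ac
      (withDensity_absolutelyContinuous _ _)
  rw [LocalParam.measure, Measure.map_apply_of_aemeasurable hm hE, withDensity_apply',
    Measure.restrict_restrict' p.isOpen_domain.measurableSet]

/-- This is where the positive diagonal is needed: if `U j j = 0`, a phase in row `j` can be moved
between `T` and `U`. -/
theorem LocalParam.injOn_lowerMulMap (p : UnitaryParam n)
    {E : Set (Matrix (Fin n) (Fin n) ℂ)} (hE : E ⊆ posDiag n) :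
    Set.InjOn (lowerMulMap p.toFun) ((p.toFun ⁻¹' E ∩ p.domain) ×ˢ lowerUnits n) := by
  rintro ⟨x, s⟩ ⟨hx, hs⟩ ⟨y, t⟩ ⟨hy, ht⟩ h
  have h' := (coordEquiv n).injective h
  obtain ⟨h1, h2⟩ := lower_mul_unitary_unique (isLower_lowerMatrix s) (isLower_lowerMatrix t)
    (isUnit_det_lowerMatrix ht) (p.mapsTo hx.2) (p.mapsTo hy.2) (hE hx.1) (hE hy.1) h'
  exact Prod.ext (p.injOn hx.2 hy.2 h2) (lowerMatrix_injective h1)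

/-- The Gaussian mass of the matrices `T U` with `T` lower triangular and `U` in a piece of
`U₁(n)` is proportional to the measure of the piece. -/
theorem LocalParam.lintegral_gauss_image (p : UnitaryParam n)
    {E : Set (Matrix (Fin n) (Fin n) ℂ)} (hE : MeasurableSet E) (hpos : E ⊆ posDiag n) :
    ∫⁻ w in lowerMulMap p.toFun '' ((p.toFun ⁻¹' E ∩ p.domain) ×ˢ lowerUnits n),
      gauss ((coordEquiv n).symm w) =
    p.measure (dGForm n) E *
      ∫⁻ t in lowerUnits n, lowerWeight t * gauss (lowerMatrix t) := by
  have hS := p.measurableSet_preimage hE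
  have hdiff : ∀ x ∈ p.domain, DifferentiableAt ℝ p.toFun x := fun x hx =>
    (p.contDiffOn.contDiffAt (p.isOpen_domain.mem_nhds hx)).differentiableAt one_ne_zero
  rw [lintegral_image_eq_lintegral_abs_det_fderiv_mul volume
    (hS.prod isOpen_lowerUnits.measurableSet)
    (fun w hw => (hasFDerivAt_lowerMulMap (hdiff w.1 hw.1.2)).hasFDerivWithinAt)
    (p.injOn_lowerMulMap hpos)]
  have hcongr : ∀ w ∈ (p.toFun ⁻¹' E ∩ p.domain) ×ˢ lowerUnits n,
      ENNReal.ofReal |(LinearMap.toContinuousLinearMap (lowerMulDeriv (lowerMatrix w.2)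
        (p.toFun w.1) (fderiv ℝ p.toFun w.1).toLinearMap)).det| *
        gauss ((coordEquiv n).symm (lowerMulMap p.toFun w)) =
      ENNReal.ofReal (p.density (dGForm n) w.1) *
        (lowerWeight w.2 * gauss (lowerMatrix w.2)) := by
    -- The integrand splits into a function of `x` and a function of `t`: the Jacobian factors, and
    -- the Gaussian of `T U` equals that of `T`.
    intro w hw
    have hU := realDiagUnitary.mul_star (p.mapsTo hw.1.2)
    have hdet := abs_det_lowerMulDeriv (isLower_lowerMatrix w.2) hU
      (fderiv ℝ p.toFun w.1).toLinearMap
    have hg : gauss ((coordEquiv n).symm (lowerMulMap p.toFun w)) = gauss (lowerMatrix w.2) := by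
      rw [lowerMulMap, LinearEquiv.symm_apply_apply, gauss, frobSq_mul_unitary _ hU, gauss]
    rw [hg, ContinuousLinearMap.det, LinearMap.coe_toContinuousLinearMap, hdet,
      ENNReal.ofReal_mul (Finset.prod_nonneg fun j _ => by positivity)]
    simp only [lowerMatrix_diag]
    rw [← mul_assoc, mul_comm (ENNReal.ofReal (p.density (dGForm n) w.1))]
    rfl
  rw [setLIntegral_congr_fun (hS.prod isOpen_lowerUnits.measurableSet) hcongr,
    Measure.volume_eq_prod, ← Measure.prod_restrict, lintegral_prod_mul
      (f := fun x => ENNReal.ofReal (p.density (dGForm n) x))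
      (g := fun t : LowerCoord n => lowerWeight t * gauss (lowerMatrix t)),
    p.measure_apply hE]
  · exact (((p.continuousOn_density.mono Set.inter_subset_right).aemeasurable hS)).ennreal_ofReal
  · exact (measurable_lowerWeight.mul measurable_gauss_lowerMatrix).aemeasurable

/-! ### Points where a diagonal entry vanishes -/

/-- The conjugate transpose as a real linear map. -/
def conjTransposeLin (n : ℕ) : Matrix (Fin n) (Fin n) ℂ →ₗ[ℝ] Matrix (Fin n) (Fin n) ℂ where
  toFun M := M.conjTranspose
  map_add' M N := Matrix.conjTranspose_add M N
  map_smul' c M := by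
    ext i j
    simp [Matrix.conjTranspose_apply]

theorem LocalParam.differentiableAt (p : UnitaryParam n) {x : UpperCoord n} (hx : x ∈ p.domain) :
    DifferentiableAt ℝ p.toFun x :=
  (p.contDiffOn.contDiffAt (p.isOpen_domain.mem_nhds hx)).differentiableAt one_ne_zero

/-- Obtained by differentiating `U U* = 1` along the parametrization. -/
theorem LocalParam.fderiv_antihermitian (p : UnitaryParam n) {x : UpperCoord n}
    (hx : x ∈ p.domain) (v : UpperCoord n) :
    (fderiv ℝ p.toFun x v * (p.toFun x).conjTranspose).conjTranspose =
      -(fderiv ℝ p.toFun x v * (p.toFun x).conjTranspose) := by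
  let B := (LinearMap.mul ℝ (Matrix (Fin n) (Fin n) ℂ)).toContinuousBilinearMap
  let C := LinearMap.toContinuousLinearMap (conjTransposeLin n)
  have h1 := (p.differentiableAt hx).hasFDerivAt
  have h2 : HasFDerivAt (fun y => C (p.toFun y)) (C.comp (fderiv ℝ p.toFun x)) x :=
    C.hasFDerivAt.comp x h1
  have h3 := B.hasFDerivAt_of_bilinear h1 h2
  have h4 : (fun y => B (p.toFun y) (C (p.toFun y))) =ᶠ[nhds x] fun _ => 1 := by
    filter_upwards [p.isOpen_domain.mem_nhds hx] with y hy
    exact realDiagUnitary.mul_star (p.mapsTo hy)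
  have h5 := h3.unique
    ((hasFDerivAt_const (1 : Matrix (Fin n) (Fin n) ℂ) x).congr_of_eventuallyEq h4)
  have h6 := DFunLike.congr_fun h5 v
  have h7 : p.toFun x * (fderiv ℝ p.toFun x v).conjTranspose +
      fderiv ℝ p.toFun x v * (p.toFun x).conjTranspose = 0 := h6
  rw [Matrix.conjTranspose_mul, Matrix.conjTranspose_conjTranspose]
  exact eq_neg_of_add_eq_zero_left h7

/-- The real part of the entry is nonnegative and vanishes at `x`, so it has a local minimum there;
the imaginary part is identically zero. -/
theorem LocalParam.fderiv_diag_eq_zero (p : UnitaryParam n) {x : UpperCoord n}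
    (hx : x ∈ p.domain) {j : Fin n} (hj : p.toFun x j j = 0) (v : UpperCoord n) :
    fderiv ℝ p.toFun x v j j = 0 := by
  let R : Matrix (Fin n) (Fin n) ℂ →L[ℝ] ℝ := LinearMap.toContinuousLinearMap
    (Complex.reLm ∘ₗ (Matrix.entryLinearMap ℝ ℂ j j))
  let I : Matrix (Fin n) (Fin n) ℂ →L[ℝ] ℝ := LinearMap.toContinuousLinearMap
    (Complex.imLm ∘ₗ (Matrix.entryLinearMap ℝ ℂ j j))
  have h1 := (p.differentiableAt hx).hasFDerivAt
  have hR : HasFDerivAt (fun y => R (p.toFun y)) (R.comp (fderiv ℝ p.toFun x)) x :=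
    R.hasFDerivAt.comp x h1
  have hI : HasFDerivAt (fun y => I (p.toFun y)) (I.comp (fderiv ℝ p.toFun x)) x :=
    I.hasFDerivAt.comp x h1
  have hmin : IsLocalMin (fun y => R (p.toFun y)) x := by
    filter_upwards [p.isOpen_domain.mem_nhds hx] with y hy
    have h0 : R (p.toFun x) = 0 := by simp [R, hj]
    rw [h0]
    exact ((p.mapsTo hy).2 j).2
  have hR0 := DFunLike.congr_fun (hmin.hasFDerivAt_eq_zero hR) v
  have hconst : (fun y => I (p.toFun y)) =ᶠ[nhds x] fun _ => 0 := by
    filter_upwards [p.isOpen_domain.mem_nhds hx] with y hy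
    exact ((p.mapsTo hy).2 j).1
  have hI0 := DFunLike.congr_fun
    (hI.unique ((hasFDerivAt_const (0 : ℝ) x).congr_of_eventuallyEq hconst)) v
  exact Complex.ext hR0 hI0

theorem antihermitian_offDiag_eq {K L : Matrix (Fin n) (Fin n) ℂ} (hK : K.conjTranspose = -K)
    (hL : L.conjTranspose = -L) (h : upperPart K = upperPart L) {j k : Fin n} (hjk : j ≠ k) :
    K j k = L j k := by
  have hup : ∀ {a b : Fin n}, a < b → K a b = L a b := fun {a b} hab =>
    Complex.ext (congrFun h (Sum.inl ⟨(a, b), hab⟩)) (congrFun h (Sum.inr ⟨(a, b), hab⟩))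
  rcases lt_or_gt_of_ne hjk with hlt | hlt
  · exact hup hlt
  · have h1 : K j k = -star (K k j) := by
      have := congrFun (congrFun hK j) k
      rw [Matrix.conjTranspose_apply, Matrix.neg_apply] at this
      rw [this, neg_neg]
    have h2 : L j k = -star (L k j) := by
      have := congrFun (congrFun hL j) k
      rw [Matrix.conjTranspose_apply, Matrix.neg_apply] at this
      rw [this, neg_neg]
    rw [h1, h2, hup hlt]

/-- At a point of `U₁(n)` with a vanishing diagonal entry, the form `⋀ dG₁` vanishes on every
tangent space of a parametrization. -/
theorem LocalParam.density_eq_zero (p : UnitaryParam n) {x : UpperCoord n}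
    (hx : x ∈ p.domain) {j : Fin n} (hj : p.toFun x j j = 0) :
    p.density (dGForm n) x = 0 := by
  set U := p.toFun x with hU
  set D := fderiv ℝ p.toFun x with hD
  have hUU := realDiagUnitary.mul_star (p.mapsTo hx)
  have hUU' := realDiagUnitary.star_mul (p.mapsTo hx)
  rw [← hU] at hUU hUU'
  set B : Matrix (UpperPair n ⊕ UpperPair n) (UpperPair n ⊕ UpperPair n) ℝ :=
    Matrix.of fun i k => dGForm n i U (D (Pi.single k 1)) with hB
  change |B.det| = 0
  by_contra hne
  have hdet : IsUnit B.det := isUnit_iff_ne_zero.2 fun h0 => hne (by rw [h0, abs_zero])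
  have hBv : ∀ v, B.mulVec v = upperPart (D v * U.conjTranspose) := by
    have : Matrix.toLin' B =
        upperPart ∘ₗ LinearMap.mulRight ℝ U.conjTranspose ∘ₗ D.toLinearMap := by
      apply LinearMap.toMatrix'.injective
      rw [LinearMap.toMatrix'_toLin']
      ext i k
      rw [LinearMap.toMatrix'_apply, hB, Matrix.of_apply, dGForm_apply]
      simp
    intro v
    exact DFunLike.congr_fun this v
  -- Column `j` of `U` is a unit vector.
  obtain ⟨k, hk⟩ : ∃ k, U k j ≠ 0 := by
    by_contra! hall
    have h1 := congrFun (congrFun hUU' j) j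
    rw [Matrix.mul_apply, Finset.sum_eq_zero (fun l _ => by rw [hall l, mul_zero]),
      Matrix.one_apply_eq] at h1
    exact zero_ne_one h1
  have hkj : j ≠ k := fun h => hk (h ▸ hj)
  -- `A` is antihermitian with `(A U)_jj = |U_kj|² ≠ 0`. If the form did not vanish, some tangent
  -- vector `D v` would have `D v · U*` equal to `A` off the diagonal, and then `(D v)_jj` would be
  -- nonzero.
  set A : Matrix (Fin n) (Fin n) ℂ := Matrix.single j k (star (U k j)) -
    Matrix.single k j (U k j) with hA
  have hAanti : A.conjTranspose = -A := by
    rw [hA, Matrix.conjTranspose_sub, Matrix.conjTranspose_single, Matrix.conjTranspose_single,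
      star_star, neg_sub]
  obtain ⟨v, hv⟩ := (Matrix.mulVec_surjective_iff_isUnit.2
    ((Matrix.isUnit_iff_isUnit_det B).2 hdet)) (upperPart A)
  rw [hBv] at hv
  have hoff : ∀ l, l ≠ j → (D v * U.conjTranspose) j l = A j l := fun l hl =>
    antihermitian_offDiag_eq (p.fderiv_antihermitian hx v) hAanti hv hl.symm
  have h0 : (D v * U.conjTranspose * U) j j = 0 := by
    rw [Matrix.mul_assoc, hUU', Matrix.mul_one]
    exact p.fderiv_diag_eq_zero hx hj v
  rw [Matrix.mul_apply, Finset.sum_eq_single k] at h0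
  · rw [hoff k hkj.symm, hA] at h0
    simp [hkj, hkj.symm, hk] at h0
  · intro l _ hl
    -- The diagonal entry of `D v · U*` is not controlled by the form, but it is multiplied by `U j
    -- j = 0`.
    by_cases hlj : l = j
    · rw [hlj, hj, mul_zero]
    · rw [hoff l hlj, hA]
      simp [hl.symm, hkj.symm]
  · simp

theorem measurableSet_posDiag : MeasurableSet (posDiag n) := by
  have h : posDiag n = ⋂ j, {U : Matrix (Fin n) (Fin n) ℂ | 0 < (U j j).re} := by
    ext U
    simp [posDiag]
  rw [h]
  refine MeasurableSet.iInter fun j => IsOpen.measurableSet ?_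
  exact isOpen_lt continuous_const (Complex.continuous_re.comp (continuous_id.matrix_elem j j))

theorem LocalParam.measure_compl_posDiag (p : UnitaryParam n) :
    p.measure (dGForm n) (posDiag n)ᶜ = 0 := by
  rw [p.measure_apply measurableSet_posDiag.compl]
  rw [setLIntegral_congr_fun (p.measurableSet_preimage measurableSet_posDiag.compl)
    (g := fun _ => 0), lintegral_zero]
  rintro x ⟨hx, hxd⟩
  obtain ⟨j, hj⟩ : ∃ j, ¬ 0 < (p.toFun x j j).re := by simpa [posDiag] using hx
  have h := (p.mapsTo hxd).2 j
  have h0 : p.toFun x j j = 0 := Complex.ext (le_antisymm (not_lt.1 hj) h.2) h.1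
  simp only [p.density_eq_zero hxd h0, ENNReal.ofReal_zero]

/-! ### Zero sets of analytic functions -/

/-- The zeros are isolated, hence countable. -/
theorem ae_ne_zero_of_analytic_line {F : Type*} [NormedAddCommGroup F] [NormedSpace ℝ F]
    {g : ℝ → F} (hg : AnalyticOnNhd ℝ g Set.univ) (h0 : g 0 ≠ 0) : ∀ᵐ s, g s ≠ 0 := by
  have h1 := hg.preimage_zero_mem_codiscrete h0
  have h2 : IsDiscrete (g ⁻¹' {0}) := by
    have := isDiscrete_of_codiscreteWithin (U := Set.univ) (s := g ⁻¹' {0})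
      (by rwa [← Set.preimage_compl])
    rwa [Set.inter_univ] at this
  have h3 : DiscreteTopology (g ⁻¹' {0}) := h2.to_subtype
  have h4 : (g ⁻¹' {0}).Countable := Set.countable_coe_iff.1 countable_of_Lindelof_of_discrete
  rw [ae_iff]
  have h5 : {a | ¬ g a ≠ 0} = g ⁻¹' {0} := by
    ext a
    simp
  rw [h5]
  exact h4.measure_zero volume

/-- The zero set of an analytic function which is not identically zero is a null set. -/
theorem measure_zeros_of_contDiff_omega {E F : Type*} [NormedAddCommGroup E] [NormedSpace ℝ E]
    [FiniteDimensional ℝ E] [MeasurableSpace E] [BorelSpace E] (μ : Measure E)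
    [μ.IsAddHaarMeasure] [NormedAddCommGroup F] [NormedSpace ℝ F] {f : E → F}
    (hf : ContDiff ℝ ω f) {a : E} (ha : f a ≠ 0) : μ {x | f x = 0} = 0 := by
  set Z : Set E := {x | f (a + x) = 0} with hZ
  have hZ0 : μ {x | f x = 0} = μ Z := by
    rw [← measure_preimage_add μ a {x | f x = 0}]
    rfl
  rw [hZ0]
  have hline : ∀ x : E, ∀ᵐ s : ℝ, f (a + s • x) ≠ 0 := fun x => by
    refine ae_ne_zero_of_analytic_line ?_ (by simpa using ha)
    have : ContDiff ℝ ω fun s : ℝ => f (a + s • x) :=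
      hf.comp (contDiff_const.add (contDiff_id.smul contDiff_const))
    exact this.analyticOnNhd
  have hmeas : MeasurableSet {q : E × ℝ | f (a + q.2 • q.1) ≠ 0} := by
    refine (isOpen_ne_fun ?_ continuous_const).measurableSet
    exact hf.continuous.comp (by fun_prop)
  -- Every line through `a` meets the zero set in a null set. By Fubini there is one `s ≠ 0` such
  -- that `f (a + s • x) ≠ 0` for almost every `x`, and scaling by `s` preserves null sets.
  have h1 := (Measure.ae_ae_comm (μ := μ) (ν := (volume : Measure ℝ))
    (p := fun x s => f (a + s • x) ≠ 0) hmeas).1 (Filter.Eventually.of_forall hline)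
  have h2 : ∀ᵐ s : ℝ, s ≠ 0 := by
    rw [ae_iff]
    simp
  obtain ⟨s, hs, hs0⟩ := (h1.and h2).exists
  rw [ae_iff] at hs
  have h3 : {x | ¬ f (a + s • x) ≠ 0} = (s • ·) ⁻¹' Z := by
    ext x
    simp [hZ]
  rw [h3, Measure.addHaar_preimage_smul μ hs0, mul_eq_zero, ENNReal.ofReal_eq_zero] at hs
  rcases hs with hs | hs
  · exact absurd hs (not_le.2 (abs_pos.2 (inv_ne_zero (pow_ne_zero _ hs0))))
  · exact hs

/-! ### Unipotent matrices and the Gram-Schmidt process -/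

/-- The upper unipotent matrix with given entries above the diagonal. -/
def unipotent (x : UpperCoord n) : Matrix (Fin n) (Fin n) ℂ := 1 + upperMatrix x

theorem unipotent_diag (x : UpperCoord n) (j : Fin n) : unipotent x j j = 1 := by
  simp [unipotent, upperMatrix_of_le]

theorem unipotent_below (x : UpperCoord n) {j k : Fin n} (h : k < j) : unipotent x j k = 0 := by
  simp [unipotent, upperMatrix_of_le _ h.le, Matrix.one_apply_ne h.ne']

theorem unipotent_blockTriangular (x : UpperCoord n) : (unipotent x).BlockTriangular id :=
  fun _ _ h => unipotent_below x h

theorem det_unipotent (x : UpperCoord n) : (unipotent x).det = 1 := by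
  rw [Matrix.det_of_isUpperTriangular (unipotent_blockTriangular x)]
  simp [unipotent_diag]

theorem unipotent_injective : Function.Injective (unipotent (n := n)) := fun x y h => by
  rw [← upperPart_upperMatrix x, ← upperPart_upperMatrix y]
  exact congrArg upperPart (add_left_cancel h)

theorem eq_unipotent {M : Matrix (Fin n) (Fin n) ℂ} (h : ∀ j k, k < j → M j k = 0)
    (h1 : ∀ j, M j j = 1) : M = unipotent (upperPart M) := by
  have hl : lowerMatrix (lowerPart M) = 1 := by
    ext j k
    rcases lt_trichotomy j k with hjk | rfl | hjk
    · rw [lowerMatrix_above _ hjk, Matrix.one_apply_ne hjk.ne]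
    · rw [lowerMatrix_diag, lowerPart_fst, h1, Matrix.one_apply_eq]
    · rw [lowerMatrix_below _ hjk, lowerPart_snd, h _ _ hjk, Matrix.one_apply_ne hjk.ne']
  rw [unipotent, ← hl, add_comm, upperMatrix_add_lowerMatrix]

/-- `L` is lower triangular and also a product of upper unipotents, hence the identity. This gives
injectivity of the chart. -/
theorem lower_mul_unipotent_unique {L : Matrix (Fin n) (Fin n) ℂ} (hL : IsLower L)
    {x y : UpperCoord n} (h : L * unipotent x = unipotent y) : x = y := by
  have hu : IsUnit (unipotent x).det := by rw [det_unipotent]; exact isUnit_one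
  have : Invertible (unipotent x) := Matrix.invertibleOfIsUnitDet _ hu
  have hLe : L = unipotent y * (unipotent x)⁻¹ := by
    rw [← h, Matrix.mul_assoc, Matrix.mul_nonsing_inv _ hu, Matrix.mul_one]
  have hup : L.BlockTriangular id := by
    rw [hLe]
    exact (unipotent_blockTriangular y).mul
      (Matrix.blockTriangular_inv_of_blockTriangular (unipotent_blockTriangular x))
  have hoff : ∀ j k, j ≠ k → L j k = 0 := fun j k hjk => by
    rcases lt_or_gt_of_ne hjk with hlt | hlt
    · exact hL hlt
    · exact hup hlt
  have hdiag : ∀ j, L j j = 1 := fun j => by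
    have h1 := congrFun (congrFun h j) j
    rw [Matrix.mul_apply, Finset.sum_eq_single j
      (fun l _ hl => by rw [hoff j l hl.symm, zero_mul]) (by simp), unipotent_diag,
      unipotent_diag, mul_one] at h1
    exact h1
  have hL1 : L = 1 := by
    ext j k
    by_cases hjk : j = k
    · rw [hjk, hdiag, Matrix.one_apply_eq]
    · rw [hoff j k hjk, Matrix.one_apply_ne hjk]
  rw [hL1, Matrix.one_mul] at h
  exact unipotent_injective h

/-- The rows of the unipotent matrix. -/
def unipotentRow (x : UpperCoord n) (j : Fin n) : EuclideanSpace ℂ (Fin n) :=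
  WithLp.toLp 2 (unipotent x j)

/-- The orthogonalized rows of the unipotent matrix. -/
def gsRow (x : UpperCoord n) (j : Fin n) : EuclideanSpace ℂ (Fin n) :=
  InnerProductSpace.gramSchmidt ℂ (unipotentRow x) j

theorem linearIndependent_unipotentRow (x : UpperCoord n) :
    LinearIndependent ℂ (unipotentRow x) := by
  have h : LinearIndependent ℂ (unipotent x).row := by
    rw [Matrix.linearIndependent_rows_iff_isUnit, Matrix.isUnit_iff_isUnit_det, det_unipotent]
    exact isUnit_one
  exact h.map' (WithLp.linearEquiv 2 ℂ (Fin n → ℂ)).symm.toLinearMap (LinearEquiv.ker _)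

theorem gsRow_ne_zero (x : UpperCoord n) (j : Fin n) : gsRow x j ≠ 0 :=
  InnerProductSpace.gramSchmidt_ne_zero j (linearIndependent_unipotentRow x)

theorem gsRow_orthogonal (x : UpperCoord n) {j k : Fin n} (h : j ≠ k) :
    ⟪gsRow x j, gsRow x k⟫_ℂ = 0 := InnerProductSpace.gramSchmidt_orthogonal ℂ _ h

theorem contDiff_unipotent_apply (j k : Fin n) :
    ContDiff ℝ ω fun x : UpperCoord n => unipotent x j k := by
  have h : ContDiff ℝ ω (Matrix.entryLinearMap ℝ ℂ j k ∘ₗ upperMatrix : UpperCoord n →ₗ[ℝ] ℂ) :=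
    (LinearMap.toContinuousLinearMap
      (Matrix.entryLinearMap ℝ ℂ j k ∘ₗ upperMatrix : UpperCoord n →ₗ[ℝ] ℂ)).contDiff
  exact contDiff_const.add h

theorem contDiff_unipotentRow (j : Fin n) :
    ContDiff ℝ ω fun x : UpperCoord n => unipotentRow x j := by
  rw [contDiff_piLp 2]
  exact fun k => contDiff_unipotent_apply j k

/-- By recursion each row is a rational expression in inner products. The denominators `⟪gsRow x i,
gsRow x i⟫` never vanish, because the rows of a unipotent matrix are independent. -/
theorem contDiff_gsRow (j : Fin n) : ContDiff ℝ ω fun x : UpperCoord n => gsRow x j := by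
  induction j using WellFoundedLT.induction with
  | _ j ih =>
    have h : (fun x : UpperCoord n => gsRow x j) = fun x => unipotentRow x j -
        ∑ i ∈ Finset.Iio j, (⟪gsRow x i, unipotentRow x j⟫_ℂ * (⟪gsRow x i, gsRow x i⟫_ℂ)⁻¹) •
          gsRow x i := by
      ext1 x
      rw [eq_sub_iff_add_eq]
      refine Eq.trans ?_ (InnerProductSpace.gramSchmidt_def'' ℂ (unipotentRow x) j).symm
      simp only [inner_self_eq_norm_sq_to_K, div_eq_mul_inv]
      rfl
    rw [h]
    refine (contDiff_unipotentRow j).sub (ContDiff.sum fun i hi => ?_)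
    have hi' := ih i (Finset.mem_Iio.1 hi)
    refine ContDiff.smul (ContDiff.mul (hi'.inner ℂ (contDiff_unipotentRow j)) ?_) hi'
    exact (hi'.inner ℂ hi').inv fun x => inner_self_ne_zero.2 (gsRow_ne_zero x i)

theorem contDiff_gsRow_apply (j k : Fin n) : ContDiff ℝ ω fun x : UpperCoord n => gsRow x j k :=
  (contDiff_piLp 2).1 (contDiff_gsRow j) k

/-- Supplies a point where no diagonal entry vanishes, so that the analytic zero set argument
applies to the complement of the chart domain. -/
theorem gsRow_zero (j : Fin n) : gsRow (0 : UpperCoord n) j = EuclideanSpace.single j 1 := by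
  have hrow : ∀ i, unipotentRow (0 : UpperCoord n) i = EuclideanSpace.single i 1 := fun i => by
    ext k
    simp [unipotentRow, unipotent, Matrix.one_apply, eq_comm]
  rw [gsRow, InnerProductSpace.gramSchmidt_of_orthogonal, hrow]
  intro i k hik
  simp [hrow, EuclideanSpace.inner_single_left, hik]

/-! ### The chart of `U₁(n)` -/

/-- The domain of the chart: no orthogonalized row has a vanishing diagonal entry. -/
def chartDomain (n : ℕ) : Set (UpperCoord n) := {x | ∀ j, gsRow x j j ≠ 0}

/-- The factor which normalizes an orthogonalized row. -/
def rowFactor (x : UpperCoord n) (j : Fin n) : ℂ :=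
  star (gsRow x j j) * ((‖gsRow x j j‖ * ‖gsRow x j‖ : ℝ) : ℂ)⁻¹

/-- The unitary matrix with positive diagonal obtained from the rows of a unipotent matrix. -/
def chartFun (x : UpperCoord n) : Matrix (Fin n) (Fin n) ℂ :=
  Matrix.of fun j k => rowFactor x j * gsRow x j k

theorem isOpen_chartDomain : IsOpen (chartDomain n) := by
  rw [chartDomain, Set.ofPred_forall]
  exact isOpen_iInter_of_finite fun j =>
    isOpen_ne_fun (contDiff_gsRow_apply j j).continuous continuous_const

theorem volume_compl_chartDomain : volume (chartDomain n)ᶜ = 0 := by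
  have h : (chartDomain n)ᶜ = ⋃ j, {x : UpperCoord n | gsRow x j j = 0} := by
    ext x
    simp [chartDomain]
  rw [h, measure_iUnion_null_iff]
  intro j
  refine measure_zeros_of_contDiff_omega volume (contDiff_gsRow_apply j j) (a := 0) ?_
  rw [gsRow_zero]
  simp

theorem contDiffOn_chartFun : ContDiffOn ℝ 1 chartFun (chartDomain n) := by
  have hentry : ∀ j k : Fin n, ContDiffOn ℝ 1 (fun x => chartFun x j k) (chartDomain n) := by
    intro j k
    have h1 : ∀ k, ContDiffOn ℝ 1 (fun x : UpperCoord n => gsRow x j k) (chartDomain n) :=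
      fun k => ((contDiff_gsRow_apply j k).of_le le_top).contDiffOn
    have h2 : ContDiffOn ℝ 1 (fun x : UpperCoord n => gsRow x j) (chartDomain n) :=
      ((contDiff_gsRow j).of_le le_top).contDiffOn
    have h3 : ContDiffOn ℝ 1 (fun x : UpperCoord n => star (gsRow x j j)) (chartDomain n) :=
      Complex.conjCLE.contDiff.comp_contDiffOn (h1 j)
    have h4 : ContDiffOn ℝ 1 (fun x : UpperCoord n =>
        ((‖gsRow x j j‖ * ‖gsRow x j‖ : ℝ) : ℂ)) (chartDomain n) :=
      Complex.ofRealCLM.contDiff.comp_contDiffOn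
        (((h1 j).norm ℂ fun x hx => hx j).mul (h2.norm ℂ fun x _ => gsRow_ne_zero x j))
    refine (h3.mul (h4.inv fun x hx => ?_)).mul (h1 k)
    exact Complex.ofReal_ne_zero.2 (mul_ne_zero (norm_ne_zero_iff.2 (hx j))
      (norm_ne_zero_iff.2 (gsRow_ne_zero x j)))
  exact contDiffOn_pi.2 fun j => contDiffOn_pi.2 fun k => hentry j k

theorem rowFactor_ne_zero {x : UpperCoord n} (hx : x ∈ chartDomain n) (j : Fin n) :
    rowFactor x j ≠ 0 :=
  mul_ne_zero (star_ne_zero.2 (hx j)) (inv_ne_zero (Complex.ofReal_ne_zero.2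
    (mul_ne_zero (norm_ne_zero_iff.2 (hx j)) (norm_ne_zero_iff.2 (gsRow_ne_zero x j)))))

theorem norm_rowFactor {x : UpperCoord n} (hx : x ∈ chartDomain n) (j : Fin n) :
    ‖rowFactor x j‖ = ‖gsRow x j‖⁻¹ := by
  have h := norm_ne_zero_iff.2 (hx j)
  have h' := norm_ne_zero_iff.2 (gsRow_ne_zero x j)
  rw [rowFactor, norm_mul, norm_star, norm_inv, Complex.norm_of_nonneg (by positivity)]
  field_simp

theorem chartFun_diag {x : UpperCoord n} (hx : x ∈ chartDomain n) (j : Fin n) :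
    chartFun x j j = ((‖gsRow x j j‖ * ‖gsRow x j‖⁻¹ : ℝ) : ℂ) := by
  have h : ((‖gsRow x j j‖ : ℝ) : ℂ) ≠ 0 := Complex.ofReal_ne_zero.2 (norm_ne_zero_iff.2 (hx j))
  have h' : ((‖gsRow x j‖ : ℝ) : ℂ) ≠ 0 :=
    Complex.ofReal_ne_zero.2 (norm_ne_zero_iff.2 (gsRow_ne_zero x j))
  have h2 : star (gsRow x j j) * gsRow x j j = ((‖gsRow x j j‖ : ℝ) : ℂ) ^ 2 :=
    Complex.conj_mul' _
  simp only [chartFun, Matrix.of_apply, rowFactor]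
  rw [mul_right_comm, h2]
  push_cast
  field_simp

theorem chartFun_mul_conjTranspose {x : UpperCoord n} (hx : x ∈ chartDomain n) :
    chartFun x * (chartFun x).conjTranspose = 1 := by
  have h : ∀ j k, (chartFun x * (chartFun x).conjTranspose) j k =
      rowFactor x j * star (rowFactor x k) * ⟪gsRow x k, gsRow x j⟫_ℂ := by
    intro j k
    rw [EuclideanSpace.inner_eq_star_dotProduct, Matrix.mul_apply, dotProduct, Finset.mul_sum]
    refine Finset.sum_congr rfl fun l _ => ?_
    simp only [Matrix.conjTranspose_apply, chartFun, Matrix.of_apply, star_mul, Pi.star_apply]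
    ring
  ext j k
  rw [h]
  by_cases hjk : j = k
  · subst hjk
    have h' : ((‖gsRow x j‖ : ℝ) : ℂ) ≠ 0 :=
      Complex.ofReal_ne_zero.2 (norm_ne_zero_iff.2 (gsRow_ne_zero x j))
    have h2 : rowFactor x j * star (rowFactor x j) = ((‖rowFactor x j‖ : ℝ) : ℂ) ^ 2 :=
      Complex.mul_conj' _
    rw [h2, norm_rowFactor hx, inner_self_eq_norm_sq_to_K, Matrix.one_apply_eq]
    push_cast
    exact (mul_pow _ _ 2).symm.trans 
      ((congrArg (· ^ 2) (inv_mul_cancel₀ h')).trans (one_pow 2))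
  · rw [gsRow_orthogonal x (Ne.symm hjk), mul_zero, Matrix.one_apply_ne hjk]

theorem chartFun_mem_posDiag {x : UpperCoord n} (hx : x ∈ chartDomain n) :
    chartFun x ∈ posDiag n := fun j => by
  rw [chartFun_diag hx, Complex.ofReal_re]
  have h := norm_pos_iff.2 (hx j)
  have h' := norm_pos_iff.2 (gsRow_ne_zero x j)
  positivity

theorem chartFun_mem {x : UpperCoord n} (hx : x ∈ chartDomain n) :
    chartFun x ∈ realDiagUnitary n :=
  ⟨Matrix.mem_unitaryGroup_iff.2 (chartFun_mul_conjTranspose hx), fun j =>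
    ⟨by rw [chartFun_diag hx, Complex.ofReal_im], (chartFun_mem_posDiag hx j).le⟩⟩

/-- Gram-Schmidt read backwards: each row of the unipotent matrix is its orthogonalized row plus a
combination of earlier ones. `C` holds these coefficients, and the inverse row factors undo the
normalization. -/
theorem exists_lower_mul_chartFun {x : UpperCoord n} (hx : x ∈ chartDomain n) :
    ∃ T : Matrix (Fin n) (Fin n) ℂ, IsLower T ∧ (∀ j, T j j ≠ 0) ∧
      unipotent x = T * chartFun x := by
  let C : Matrix (Fin n) (Fin n) ℂ := Matrix.of fun j i => if i = j then 1 else if i < j then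
    ⟪gsRow x i, unipotentRow x j⟫_ℂ / ((‖gsRow x i‖ : ℝ) : ℂ) ^ 2 else 0
  refine ⟨Matrix.of fun j i => C j i * (rowFactor x i)⁻¹, ?_, ?_, ?_⟩
  · intro j i hji
    simp [C, hji.ne', hji.le]
  · intro j
    simp [C, rowFactor_ne_zero hx j]
  · ext j k
    have h := InnerProductSpace.gramSchmidt_def'' ℂ (unipotentRow x) j
    have hk := congrArg (fun v : EuclideanSpace ℂ (Fin n) => v k) h
    have hk' : unipotent x j k = gsRow x j k + ∑ i ∈ Finset.Iio j,
        (⟪gsRow x i, unipotentRow x j⟫_ℂ / ((‖gsRow x i‖ : ℝ) : ℂ) ^ 2) * gsRow x i k := by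
      refine hk.trans ?_
      simp only [PiLp.add_apply, WithLp.ofLp_sum, Finset.sum_apply, PiLp.smul_apply, smul_eq_mul]
      rfl
    rw [hk', Matrix.mul_apply, ← Finset.sum_filter_add_sum_filter_not Finset.univ (· < j),
      Finset.sum_eq_single_of_mem (s := Finset.univ.filter fun i => ¬ i < j) j (by simp), add_comm]
    · congr 1
      · refine Finset.sum_congr (by ext; simp) fun i hi => ?_
        have hij := (Finset.mem_filter.1 hi).2
        simp only [Matrix.of_apply, C, hij.ne, hij, if_true, if_false, chartFun]
        rw [mul_assoc, inv_mul_cancel_left₀ (rowFactor_ne_zero hx i)]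
      · simp only [Matrix.of_apply, C, if_true, chartFun]
        rw [mul_assoc, inv_mul_cancel_left₀ (rowFactor_ne_zero hx j), one_mul]
    · intro i hi hij
      have : ¬ i < j := by simpa using hi
      simp [C, hij, this]

theorem isUnit_det_of_diag_ne_zero {T : Matrix (Fin n) (Fin n) ℂ} (hT : IsLower T)
    (h : ∀ j, T j j ≠ 0) : IsUnit T.det := by
  rw [hT.det_eq, isUnit_iff_ne_zero, Finset.prod_ne_zero_iff]
  exact fun j _ => h j

/-- If two points have the same image, their unipotent matrices differ by a lower triangular left
factor. -/
theorem injOn_chartFun : Set.InjOn chartFun (chartDomain n) := by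
  intro x hx y hy h
  obtain ⟨S, hS, hS0, hSx⟩ := exists_lower_mul_chartFun hx
  obtain ⟨T, hT, -, hTy⟩ := exists_lower_mul_chartFun hy
  have hu := isUnit_det_of_diag_ne_zero hS hS0
  refine lower_mul_unipotent_unique (hT.mul (hS.inv hu)) ?_
  rw [hSx, hTy, Matrix.mul_assoc, ← Matrix.mul_assoc S⁻¹, Matrix.nonsing_inv_mul _ hu,
    Matrix.one_mul, h]

/-- The chart of `U₁(n)` given by the big cell of the flag manifold. -/
def chart (n : ℕ) : UnitaryParam n where
  domain := chartDomain n
  toFun := chartFun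
  isOpen_domain := isOpen_chartDomain
  contDiffOn := contDiffOn_chartFun
  injOn := injOn_chartFun
  mapsTo := fun _ hx => chartFun_mem hx

/-! ### The chart covers almost everything -/

/-- The leading principal minors of a matrix. -/
def leadingMinor (Z : Matrix (Fin n) (Fin n) ℂ) (k : Fin n) : ℂ :=
  (Z.submatrix Subtype.val Subtype.val : Matrix {i // i < k} {i // i < k} ℂ).det

theorem contDiff_det_submatrix {ι : Type*} [Fintype ι] [DecidableEq ι] (f : ι → Fin n) :
    ContDiff ℝ ω fun w : UpperCoord n × LowerCoord n =>
      (((coordEquiv n).symm w).submatrix f f).det := by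
  simp only [Matrix.det_apply]
  refine ContDiff.sum fun σ _ => ContDiff.const_smul _ (contDiff_prod fun i _ => ?_)
  exact (LinearMap.toContinuousLinearMap (Matrix.entryLinearMap ℝ ℂ (f (σ i)) (f i) ∘ₗ
    (coordEquiv n).symm.toLinearMap)).contDiff

/-- A principal minor is a polynomial in the coordinates and equals one at the identity matrix. -/
theorem volume_det_submatrix_eq_zero {ι : Type*} [Fintype ι] [DecidableEq ι] {f : ι → Fin n}
    (hf : Function.Injective f) :
    volume {w : UpperCoord n × LowerCoord n |
      (((coordEquiv n).symm w).submatrix f f).det = 0} = 0 := by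
  refine measure_zeros_of_contDiff_omega volume (contDiff_det_submatrix f)
    (a := coordEquiv n 1) ?_
  rw [LinearEquiv.symm_apply_apply, Matrix.submatrix_one f hf, Matrix.det_one]
  exact one_ne_zero

/-- A matrix with nonvanishing leading minors is a product of a lower triangular and an upper
unipotent matrix. -/
theorem exists_lower_mul_unipotent {Z : Matrix (Fin n) (Fin n) ℂ}
    (hZ : ∀ k, leadingMinor Z k ≠ 0) (hdet : Z.det ≠ 0) :
    ∃ L : Matrix (Fin n) (Fin n) ℂ, IsLower L ∧ (∀ j, L j j ≠ 0) ∧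
      ∃ x : UpperCoord n, Z = L * unipotent x := by
  let A : ∀ k : Fin n, Matrix {i // i < k} {i // i < k} ℂ := fun k =>
    Z.submatrix Subtype.val Subtype.val
  -- Column `k` of the unipotent matrix `S` solves the linear system saying that the entries of `Z
  -- S` above the diagonal in column `k` vanish; its matrix is the leading block of `Z` with indices
  -- below `k`.
  let r : ∀ k : Fin n, {i // i < k} → ℂ := fun k => (A k)⁻¹.mulVec fun i => -Z i.1 k
  have hr : ∀ k, (A k).mulVec (r k) = fun i => -Z i.1 k := fun k => by
    rw [Matrix.mulVec_mulVec, Matrix.mul_nonsing_inv _ (isUnit_iff_ne_zero.2 (hZ k)),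
      Matrix.one_mulVec]
  let S : Matrix (Fin n) (Fin n) ℂ := Matrix.of fun j k =>
    if h : j < k then r k ⟨j, h⟩ else if j = k then 1 else 0
  have hS1 : ∀ j, S j j = 1 := fun j => by simp [S]
  have hS0 : ∀ j k, k < j → S j k = 0 := fun j k h => by simp [S, h.le, h.ne']
  have hSx := eq_unipotent hS0 hS1
  have hSdet : S.det = 1 := by rw [hSx, det_unipotent]
  have hSu : IsUnit S.det := by rw [hSdet]; exact isUnit_one
  have hlow : IsLower (Z * S) := by
    intro i k hik
    rw [Matrix.mul_apply, ← Finset.sum_filter_add_sum_filter_not Finset.univ (· < k),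
      Finset.sum_eq_single_of_mem (s := Finset.univ.filter fun j => ¬ j < k) k (by simp), hS1,
      mul_one]
    · rw [Finset.sum_subtype _ (p := fun j => j < k) (by simp)]
      have h := congrFun (hr k) ⟨i, hik⟩
      rw [Matrix.mulVec, dotProduct] at h
      have hsum : ∑ j : {j // j < k}, Z i j.1 * S j.1 k =
          ∑ j, A k ⟨i, hik⟩ j * r k j := by
        refine Finset.sum_congr rfl fun j _ => ?_
        simp [S, A, j.2]
      rw [hsum, h, neg_add_cancel]
    · intro j hj hjk
      have : ¬ j < k := by simpa using hj
      rw [hS0 j k (lt_of_le_of_ne (not_lt.1 this) (Ne.symm hjk)), mul_zero]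
  have hSinv : S⁻¹.BlockTriangular id := by
    have : Invertible S := Matrix.invertibleOfIsUnitDet _ hSu
    exact Matrix.blockTriangular_inv_of_blockTriangular (fun j k h => hS0 j k h)
  have hSinv1 : ∀ j, S⁻¹ j j = 1 := fun j => by
    have h := congrFun (congrFun (Matrix.mul_nonsing_inv _ hSu) j) j
    rw [Matrix.mul_apply, Finset.sum_eq_single j, hS1, one_mul, Matrix.one_apply_eq] at h
    · exact h
    · intro l _ hl
      rcases lt_or_gt_of_ne hl with hlt | hlt
      · rw [hS0 j l hlt, zero_mul]
      · rw [hSinv hlt, mul_zero]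
    · simp
  refine ⟨Z * S, hlow, fun j => ?_, upperPart S⁻¹, ?_⟩
  -- The leading minors only go up to size `n - 1`, so the full determinant is needed for the
  -- diagonal of `Z S` to be nonzero.
  · have h : (Z * S).det ≠ 0 := by rwa [Matrix.det_mul, hSdet, mul_one]
    rw [hlow.det_eq] at h
    exact Finset.prod_ne_zero_iff.1 h j (Finset.mem_univ j)
  · rw [← eq_unipotent (M := S⁻¹) (fun j k h => hSinv h) hSinv1, Matrix.mul_assoc,
      Matrix.mul_nonsing_inv _ hSu, Matrix.mul_one]

/-- Almost every matrix is `T U` with `T` lower triangular and invertible and `U` in the image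
of the chart. -/
theorem ae_mem_image_chart :
    ∀ᵐ w : UpperCoord n × LowerCoord n,
      w ∈ lowerMulMap chartFun '' (chartDomain n ×ˢ lowerUnits n) := by
  have hminor : ∀ k : Fin n, ∀ᵐ w : UpperCoord n × LowerCoord n,
      leadingMinor ((coordEquiv n).symm w) k ≠ 0 := fun k =>
    measure_eq_zero_iff_ae_notMem.1 (volume_det_submatrix_eq_zero
      (Subtype.val_injective (p := fun i : Fin n => i < k)))
  have hdet : ∀ᵐ w : UpperCoord n × LowerCoord n, ((coordEquiv n).symm w).det ≠ 0 :=
    measure_eq_zero_iff_ae_notMem.1 (volume_det_submatrix_eq_zero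
      (Function.injective_id (α := Fin n)))
  -- Products `L · unipotent x` with `x` outside the chart domain form the image of a null set under
  -- a differentiable map of a space into itself.
  have hbad : volume (lowerMulMap (n := n) unipotent '' ((chartDomain n)ᶜ ×ˢ Set.univ)) = 0 := by
    refine addHaar_image_eq_zero_of_differentiableOn_of_addHaar_eq_zero volume ?_ ?_
    · intro w _
      refine (hasFDerivAt_lowerMulMap ?_).differentiableAt.differentiableWithinAt
      exact (differentiableAt_const _).add
        (LinearMap.toContinuousLinearMap (upperMatrix (n := n))).differentiableAt
    · rw [Measure.volume_eq_prod, Measure.prod_prod, volume_compl_chartDomain, zero_mul]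
  have hbad' : ∀ᵐ w : UpperCoord n × LowerCoord n,
      w ∉ lowerMulMap unipotent '' ((chartDomain n)ᶜ ×ˢ Set.univ) :=
    measure_eq_zero_iff_ae_notMem.1 hbad
  filter_upwards [ae_all_iff.2 hminor, hdet, hbad'] with w h1 h2 h3
  obtain ⟨L, hL, hL0, x, hx⟩ := exists_lower_mul_unipotent h1 h2
  have hxd : x ∈ chartDomain n := by
    by_contra hxd
    refine h3 ⟨(x, lowerPart L), ⟨hxd, Set.mem_univ _⟩, ?_⟩
    rw [lowerMulMap, hL.eq_lowerMatrix, ← hx, LinearEquiv.apply_symm_apply]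
  obtain ⟨T, hT, hT0, hTx⟩ := exists_lower_mul_chartFun hxd
  have hLT : IsLower (L * T) := hL.mul hT
  refine ⟨(x, lowerPart (L * T)), ⟨hxd, fun j => ?_⟩, ?_⟩
  · have hu : IsUnit (L * T).det := by
      rw [Matrix.det_mul]
      exact (isUnit_det_of_diag_ne_zero hL hL0).mul (isUnit_det_of_diag_ne_zero hT hT0)
    rw [hLT.det_eq, isUnit_iff_ne_zero, Finset.prod_ne_zero_iff] at hu
    exact hu j (Finset.mem_univ j)
  · rw [lowerMulMap, hLT.eq_lowerMatrix, Matrix.mul_assoc, ← hTx, ← hx,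
      LinearEquiv.apply_symm_apply]

/-! ### The measure of `U₁(n)` -/

theorem lintegral_lowerWeight_ne_zero :
    ∫⁻ t in lowerUnits n, lowerWeight t * gauss (lowerMatrix t) ≠ 0 := by
  rw [lintegral_lowerWeight]
  have := Real.pi_pos
  exact (ENNReal.ofReal_pos.2 (by positivity)).ne'

theorem lintegral_lowerWeight_ne_top :
    ∫⁻ t in lowerUnits n, lowerWeight t * gauss (lowerMatrix t) ≠ ⊤ := by
  rw [lintegral_lowerWeight]
  exact ENNReal.ofReal_ne_top

/-- Up to the same constant, both measures are Gaussian masses of sets of products `T U`. By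
uniqueness of the factorization, almost every product coming from `p` is one coming from the chart,
so comparing masses replaces a transition map between the parametrizations. -/
theorem LocalParam.measure_le_chart (p : UnitaryParam n) :
    p.measure (dGForm n) ≤ (chart n).measure (dGForm n) := by
  refine Measure.le_iff.2 fun E hE => ?_
  have hEp : MeasurableSet (E ∩ posDiag n) := hE.inter measurableSet_posDiag
  have h1 : p.measure (dGForm n) E ≤ p.measure (dGForm n) (E ∩ posDiag n) := by
    refine (measure_le_inter_add_sdiff _ E (posDiag n)).trans ?_
    rw [measure_mono_null (s := E \ posDiag n) (t := (posDiag n)ᶜ) (fun _ h => h.2)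
      p.measure_compl_posDiag, add_zero]
  refine h1.trans (le_trans ?_ (measure_mono (Set.inter_subset_left (t := posDiag n))))
  -- The common constant is nonzero and finite, so it may be multiplied in.
  refine (ENNReal.mul_le_mul_iff_left (lintegral_lowerWeight_ne_zero (n := n))
    lintegral_lowerWeight_ne_top).1 ?_
  rw [← p.lintegral_gauss_image hEp Set.inter_subset_right,
    ← (chart n).lintegral_gauss_image hEp Set.inter_subset_right]
  refine lintegral_mono' ?_ le_rfl
  refine Measure.restrict_mono' ?_ le_rfl
  filter_upwards [ae_mem_image_chart (n := n)] with w hw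
  rintro ⟨⟨y, s⟩, ⟨hy, hs⟩, hys⟩
  obtain ⟨⟨x, t⟩, ⟨hx, ht⟩, hxt⟩ := hw
  have heq : lowerMatrix s * p.toFun y = lowerMatrix t * chartFun x :=
    (coordEquiv n).injective (hys.trans hxt.symm)
  obtain ⟨-, h2⟩ := lower_mul_unitary_unique (isLower_lowerMatrix s) (isLower_lowerMatrix t)
    (isUnit_det_lowerMatrix ht) (p.mapsTo hy.2) (chartFun_mem hx) hy.1.2
    (chartFun_mem_posDiag hx) heq
  refine ⟨(x, t), ⟨⟨?_, hx⟩, ht⟩, hxt⟩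
  have hmem : p.toFun y ∈ E ∩ posDiag n := hy.1
  rw [h2] at hmem
  exact hmem

theorem wedgeMeasure_eq_chart :
    wedgeMeasure (dGForm n) (realDiagUnitary n) = (chart n).measure (dGForm n) :=
  le_antisymm (iSup_le fun p => p.measure_le_chart)
    (le_iSup (fun p : UnitaryParam n => p.measure (dGForm n)) (chart n))

theorem LocalParam.measure_compl (p : UnitaryParam n) {E : Set (Matrix (Fin n) (Fin n) ℂ)}
    (hE : MeasurableSet E) (h : realDiagUnitary n ⊆ E) : p.measure (dGForm n) Eᶜ = 0 := by
  rw [p.measure_apply hE.compl]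
  have : p.toFun ⁻¹' Eᶜ ∩ p.domain = ∅ := by
    ext x
    simp only [Set.mem_inter_iff, Set.mem_preimage, Set.mem_compl_iff, Set.mem_empty_iff_false,
      iff_false, not_and]
    exact fun hx hxd => hx (h (p.mapsTo hxd))
  rw [this, Measure.restrict_empty, lintegral_zero_measure]

/-- The Gaussian identity for the full set of positive diagonals, whose products `T U` fill almost
the whole space. -/
theorem chart_measure_posDiag :
    (chart n).measure (dGForm n) (posDiag n) *
      ENNReal.ofReal (Real.pi ^ (n + Fintype.card (UpperPair n)) *
        ∏ j : Fin n, ((n - 1 - (j : ℕ)).factorial : ℝ)) =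
      ENNReal.ofReal (Real.pi ^ (2 * Fintype.card (UpperPair n) + n)) := by
  rw [← lintegral_lowerWeight, ← (chart n).lintegral_gauss_image measurableSet_posDiag subset_rfl,
    ← lintegral_gauss]
  have h : lowerMulMap (chart n).toFun ''
      (((chart n).toFun ⁻¹' posDiag n ∩ (chart n).domain) ×ˢ lowerUnits n) =ᵐ[volume]
      Set.univ := by
    rw [Filter.eventuallyEq_univ]
    filter_upwards [ae_mem_image_chart (n := n)] with w hw
    obtain ⟨⟨x, t⟩, ⟨hx, ht⟩, hxt⟩ := hw
    exact ⟨(x, t), ⟨⟨chartFun_mem_posDiag hx, hx⟩, ht⟩, hxt⟩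
  rw [setLIntegral_congr h, setLIntegral_univ]

/-! ### Restriction of the measure to `U₁(n)` and its total mass -/

theorem isClosed_realDiagUnitary : IsClosed (realDiagUnitary n) := by
  have h : realDiagUnitary n = {U : Matrix (Fin n) (Fin n) ℂ | U * U.conjTranspose = 1} ∩
      ⋂ j, ({U : Matrix (Fin n) (Fin n) ℂ | (U j j).im = 0} ∩ {U | 0 ≤ (U j j).re}) := by
    ext U
    simp only [realDiagUnitary, Matrix.mem_unitaryGroup_iff, Set.mem_inter_iff, Set.mem_iInter]
    rfl
  rw [h]
  refine (isClosed_eq (continuous_id.mul continuous_id.matrix_conjTranspose)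
    continuous_const).inter (isClosed_iInter fun j => ?_)
  have hc := Continuous.matrix_elem (continuous_id (X := Matrix (Fin n) (Fin n) ℂ)) j j
  exact (isClosed_eq (Complex.continuous_im.comp hc) continuous_const).inter
    (isClosed_le continuous_const (Complex.continuous_re.comp hc))

theorem measurableSet_realDiagUnitary : MeasurableSet (realDiagUnitary n) :=
  isClosed_realDiagUnitary.measurableSet

theorem dGMeasure_apply (E : Set (realDiagUnitary n)) :
    dGMeasure n E = (chart n).measure (dGForm n) (Subtype.val '' E) := by
  rw [dGMeasure, (MeasurableEmbedding.subtype_coe measurableSet_realDiagUnitary).comap_apply]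
  exact congrArg (fun μ : Measure (Matrix (Fin n) (Fin n) ℂ) => μ (Subtype.val '' E))
    wedgeMeasure_eq_chart

theorem dGMeasure_univ : dGMeasure n Set.univ = (chart n).measure (dGForm n) (posDiag n) := by
  rw [dGMeasure_apply, Set.image_univ, Subtype.range_val]
  have h1 := measure_add_measure_compl (μ := (chart n).measure (dGForm n))
    (measurableSet_realDiagUnitary (n := n))
  have h2 := measure_add_measure_compl (μ := (chart n).measure (dGForm n))
    (measurableSet_posDiag (n := n))
  rw [(chart n).measure_compl measurableSet_realDiagUnitary subset_rfl, add_zero] at h1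
  rw [(chart n).measure_compl_posDiag, add_zero] at h2
  rw [h1, h2]

theorem card_upperPair : Fintype.card (UpperPair n) = n * (n - 1) / 2 := by
  have h := sum_upperPair (n := n) (fun _ => 1)
  rw [Finset.sum_const, Finset.card_univ, smul_eq_mul, mul_one] at h
  rw [h, ← Finset.sum_range_id_mul_two, Nat.mul_div_cancel _ two_pos, ← Fin.sum_univ_eq_sum_range,
    Finset.sum_comm]
  refine Finset.sum_congr rfl fun m _ => ?_
  rw [Finset.sum_dite]
  simp [Finset.filter_gt_eq_Iio]

theorem prod_range_factorial (n : ℕ) : ∏ k ∈ Finset.range n, (k.factorial : ℝ) =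
    ∏ k ∈ Finset.Icc 1 (n - 1), (k.factorial : ℝ) := by
  rcases n with _ | m
  · simp
  · rw [Nat.add_sub_cancel]
    induction m with
    | zero => simp
    | succ m ih => rw [Finset.prod_range_succ, ih, Finset.prod_Icc_succ_top (by omega)]

theorem dGMeasure_univ_eq : dGMeasure n Set.univ =
    ENNReal.ofReal (Real.pi ^ (n * (n - 1) / 2) /
      ((∏ k ∈ Finset.Icc 1 (n - 1), k.factorial : ℕ) : ℝ)) := by
  have hprod : ∏ j : Fin n, ((n - 1 - (j : ℕ)).factorial : ℝ) =
      ((∏ k ∈ Finset.Icc 1 (n - 1), k.factorial : ℕ) : ℝ) := by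
    rw [Fin.prod_univ_eq_prod_range (fun j => ((n - 1 - j).factorial : ℝ)) n,
      Finset.prod_range_reflect (fun j => (j.factorial : ℝ)) n, prod_range_factorial]
    push_cast
    rfl
  have h := chart_measure_posDiag (n := n)
  rw [← dGMeasure_univ, hprod, card_upperPair] at h
  have hpi := Real.pi_pos
  have hf : (0 : ℝ) < ((∏ k ∈ Finset.Icc 1 (n - 1), k.factorial : ℕ) : ℝ) := by
    exact_mod_cast Finset.prod_pos fun k _ => Nat.factorial_pos k
  set F : ℝ := ((∏ k ∈ Finset.Icc 1 (n - 1), k.factorial : ℕ) : ℝ)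
  have ha : 0 < Real.pi ^ (n + n * (n - 1) / 2) * F := by positivity
  rw [mul_comm, ← ENNReal.eq_div_iff (ENNReal.ofReal_pos.2 ha).ne' ENNReal.ofReal_ne_top,
    ← ENNReal.ofReal_div_of_pos ha] at h
  rw [h]
  congr 1
  field_simp
  ring

/-! ### The matrix-variate gamma function -/

theorem star_complex_ofReal (r : ℝ) : star (r : ℂ) = r := Complex.conj_ofReal r

/-- Coordinates of hermitian matrices: the diagonal and the entries below it. -/
abbrev HermCoord (n : ℕ) : Type := (Fin n → ℝ) × (UpperPair n → ℂ)

instance isAddHaar_hermCoord : (volume : Measure (HermCoord n)).IsAddHaarMeasure :=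
  Measure.prod.instIsAddHaarMeasure (volume : Measure (Fin n → ℝ))
    (volume : Measure (UpperPair n → ℂ))

/-- Coordinates of the positive definite matrices. -/
def posDefCoord (n : ℕ) : Set (HermCoord n) := {w | (hermitianOf w.1 w.2).PosDef}

/-- The pair `(j + 1, k + 1)`. -/
def succPair (p : UpperPair n) : UpperPair (n + 1) :=
  ⟨(p.1.1.succ, p.1.2.succ), Fin.succ_lt_succ_iff.2 p.2⟩

/-- The pair `(0, k + 1)`. -/
def zeroPair (k : Fin n) : UpperPair (n + 1) := ⟨(0, k.succ), Fin.succ_pos k⟩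

/-- Coordinates of the rank one matrix `b b* / c`. -/
def rankOneCoord (c : ℝ) (b : Fin n → ℂ) : HermCoord n :=
  (fun j => ‖b j‖ ^ 2 / c, fun p => b p.1.2 * star (b p.1.1) / (c : ℂ))

/-- Coordinates of the lower right block. -/
def lowerBlockCoord (w : HermCoord (n + 1)) : HermCoord n :=
  (fun j => w.1 j.succ, fun p => w.2 (succPair p))

/-- Coordinates of the Schur complement of the upper left entry. -/
def schurCoord (w : HermCoord (n + 1)) : HermCoord n :=
  lowerBlockCoord w - rankOneCoord (w.1 0) fun k => w.2 (zeroPair k)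

theorem hermitianOf_isHermitian (x : Fin n → ℝ) (z : UpperPair n → ℂ) :
    (hermitianOf x z).IsHermitian := by
  ext j k
  simp only [hermitianOf, Matrix.conjTranspose_apply, Matrix.of_apply]
  rcases lt_trichotomy j k with h | rfl | h
  · simp [h, not_lt_of_gt h]
  · simp
  · simp [h, not_lt_of_gt h]

theorem hermitianOf_diag (x : Fin n → ℝ) (z : UpperPair n → ℂ) (j : Fin n) :
    hermitianOf x z j j = x j := by simp [hermitianOf]

theorem hermitianOf_below (x : Fin n → ℝ) (z : UpperPair n → ℂ) {j k : Fin n} (h : k < j) :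
    hermitianOf x z j k = z ⟨(k, j), h⟩ := by simp [hermitianOf, h]

theorem hermitianOf_above (x : Fin n → ℝ) (z : UpperPair n → ℂ) {j k : Fin n} (h : j < k) :
    hermitianOf x z j k = star (z ⟨(j, k), h⟩) := by
  simp [hermitianOf, h, not_lt_of_gt h]

/-- With `c` the upper left entry and `b` the rest of its column, the lower right block is the Schur
complement plus `b b* / c`. -/
theorem hermitianOf_succ_succ (w : HermCoord (n + 1)) (j k : Fin n) :
    hermitianOf w.1 w.2 j.succ k.succ = hermitianOf (schurCoord w).1 (schurCoord w).2 j k +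
      w.2 (zeroPair j) * star (w.2 (zeroPair k)) / (w.1 0 : ℂ) := by
  rcases lt_trichotomy j k with h | rfl | h
  · rw [hermitianOf_above _ _ h, hermitianOf_above _ _ (Fin.succ_lt_succ_iff.2 h)]
    simp only [schurCoord, lowerBlockCoord, rankOneCoord, Prod.snd_sub, Pi.sub_apply, succPair,
      star_sub, star_div₀, star_mul, star_star, star_complex_ofReal]
    ring
  · rw [hermitianOf_diag, hermitianOf_diag]
    simp only [schurCoord, lowerBlockCoord, rankOneCoord, Prod.fst_sub, Pi.sub_apply]
    have := Complex.mul_conj' (w.2 (zeroPair j))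
    rw [Complex.star_def, this]
    push_cast
    ring
  · rw [hermitianOf_below _ _ h, hermitianOf_below _ _ (Fin.succ_lt_succ_iff.2 h)]
    simp only [schurCoord, lowerBlockCoord, rankOneCoord, Prod.snd_sub, Pi.sub_apply, succPair]
    ring

/-- Completing the square in the first variable. -/
theorem quadraticForm_succ (w : HermCoord (n + 1)) (hc : w.1 0 ≠ 0) (v : Fin (n + 1) → ℂ) :
    star v ⬝ᵥ (hermitianOf w.1 w.2).mulVec v =
      (w.1 0 : ℂ) * (‖v 0 + (∑ k : Fin n, star (w.2 (zeroPair k)) * v k.succ) / (w.1 0 : ℂ)‖ : ℂ) ^ 2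
        + star (fun k : Fin n => v k.succ) ⬝ᵥ
          (hermitianOf (schurCoord w).1 (schurCoord w).2).mulVec fun k => v k.succ := by
  have hc' : (w.1 0 : ℂ) ≠ 0 := Complex.ofReal_ne_zero.2 hc
  set b : Fin n → ℂ := fun k => w.2 (zeroPair k) with hb
  set S := hermitianOf (schurCoord w).1 (schurCoord w).2 with hS
  set β := ∑ k : Fin n, star (b k) * v k.succ with hβ
  have h0 : ∀ k : Fin n, hermitianOf w.1 w.2 0 k.succ = star (b k) := fun k =>
    hermitianOf_above _ _ (Fin.succ_pos k)
  have h0' : ∀ k : Fin n, hermitianOf w.1 w.2 k.succ 0 = b k := fun k =>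
    hermitianOf_below _ _ (Fin.succ_pos k)
  have hβ' : star β = ∑ k : Fin n, star (v k.succ) * b k := by
    rw [hβ, star_sum]
    exact Finset.sum_congr rfl fun k _ => by rw [star_mul, star_star]
  have hrow : ∀ j : Fin n, (hermitianOf w.1 w.2).mulVec v j.succ =
      b j * (v 0 + β / (w.1 0 : ℂ)) + S.mulVec (fun k => v k.succ) j := by
    intro j
    rw [Matrix.mulVec, dotProduct, Fin.sum_univ_succ, h0', mul_add, hβ, Finset.sum_div,
      Finset.mul_sum, add_assoc, Matrix.mulVec, dotProduct, ← Finset.sum_add_distrib]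
    congr 1
    refine Finset.sum_congr rfl fun k _ => ?_
    rw [hermitianOf_succ_succ w]
    ring
  have hrow0 : (hermitianOf w.1 w.2).mulVec v 0 = (w.1 0 : ℂ) * (v 0 + β / (w.1 0 : ℂ)) := by
    rw [Matrix.mulVec, dotProduct, Fin.sum_univ_succ, hermitianOf_diag, mul_add,
      mul_div_cancel₀ _ hc']
    simp only [h0, hβ]
  rw [dotProduct, Fin.sum_univ_succ, hrow0]
  simp only [hrow, Pi.star_apply, mul_add (star (v _)), Finset.sum_add_distrib]
  have hsum : ∑ j : Fin n, star (v j.succ) * (b j * (v 0 + β / (w.1 0 : ℂ))) =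
      star β * (v 0 + β / (w.1 0 : ℂ)) := by
    rw [hβ', Finset.sum_mul]
    exact Finset.sum_congr rfl fun j _ => (mul_assoc _ _ _).symm
  rw [hsum, ← Complex.mul_conj', ← Complex.star_def, star_add, star_div₀,
    star_complex_ofReal, dotProduct]
  simp only [Pi.star_apply]
  field_simp
  ring

theorem mem_posDefCoord_iff (w : HermCoord n) : w ∈ posDefCoord n ↔
    ∀ v : Fin n → ℂ, v ≠ 0 → 0 < star v ⬝ᵥ (hermitianOf w.1 w.2).mulVec v := by
  rw [posDefCoord, Set.mem_ofPred_eq, Matrix.posDef_iff_dotProduct_mulVec]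
  exact ⟨fun h v hv => h.2 hv, fun h => ⟨hermitianOf_isHermitian _ _, fun v hv => h v hv⟩⟩

theorem mem_posDefCoord_succ (w : HermCoord (n + 1)) :
    w ∈ posDefCoord (n + 1) ↔ 0 < w.1 0 ∧ schurCoord w ∈ posDefCoord n := by
  constructor
  · intro h
    have hc : 0 < w.1 0 := by
      have h1 := Matrix.PosDef.diag_pos (A := hermitianOf w.1 w.2) h (i := 0)
      rw [hermitianOf_diag] at h1
      exact_mod_cast h1
    refine ⟨hc, (mem_posDefCoord_iff _).2 fun v hv => ?_⟩
    -- The first coordinate is chosen so that the completed square vanishes, leaving the form of the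
    -- Schur complement.
    have h1 := (mem_posDefCoord_iff w).1 h
      (Fin.cons (-((∑ k : Fin n, star (w.2 (zeroPair k)) * v k) / (w.1 0 : ℂ))) v) (by
        intro h0
        apply hv
        funext k
        exact congrFun h0 k.succ)
    rw [quadraticForm_succ w hc.ne'] at h1
    simpa using h1
  · rintro ⟨hc, h⟩
    refine (mem_posDefCoord_iff _).2 fun v hv => ?_
    rw [quadraticForm_succ w hc.ne']
    have hsq : ∀ u : ℂ, (0 : ℂ) ≤ (w.1 0 : ℂ) * (‖u‖ : ℂ) ^ 2 := fun u => by
      have : (0 : ℝ) ≤ w.1 0 * ‖u‖ ^ 2 := by positivity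
      exact_mod_cast this
    by_cases hv' : (fun k : Fin n => v k.succ) = 0
    · have hk : ∀ k : Fin n, v k.succ = 0 := fun k => congrFun hv' k
      have h0 : v 0 ≠ 0 := by
        intro h0
        apply hv
        funext k
        exact Fin.cases h0 hk k
      have : (0 : ℝ) < w.1 0 * ‖v 0‖ ^ 2 := by
        have := norm_pos_iff.2 h0
        positivity
      rw [hv']
      simp only [hk, mul_zero, Finset.sum_const_zero, zero_div, add_zero, Matrix.mulVec_zero,
        dotProduct_zero]
      exact_mod_cast this
    · exact add_pos_of_nonneg_of_pos (hsq _) ((mem_posDefCoord_iff _).1 h _ hv')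

/-! ### Recursion for the gamma integral at `α = n` -/

theorem measurable_schurCoord : Measurable (schurCoord (n := n)) := by
  unfold schurCoord lowerBlockCoord rankOneCoord
  refine Measurable.sub ?_ ?_
  · fun_prop
  · refine Measurable.prodMk (by fun_prop) (measurable_pi_lambda _ fun p => ?_)
    refine Measurable.div (Measurable.mul (by fun_prop) ?_) (by fun_prop)
    exact Complex.continuous_conj.measurable.comp (by fun_prop)

theorem measurableSet_posDefCoord : MeasurableSet (posDefCoord n) := by
  induction n with
  | zero =>
    convert MeasurableSet.univ
    ext w
    rw [mem_posDefCoord_iff]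
    simp only [Set.mem_univ, iff_true]
    exact fun v hv => absurd (Subsingleton.elim v 0) hv
  | succ n ih =>
    have h : posDefCoord (n + 1) = {w | 0 < w.1 0} ∩ schurCoord ⁻¹' posDefCoord n := by
      ext w
      exact mem_posDefCoord_succ w
    rw [h]
    exact (measurableSet_lt measurable_const (by fun_prop)).inter (measurable_schurCoord ih)

/-- The integrand `e^(-tr X)` on the positive definite matrices. -/
def expTrace (w : HermCoord n) : ℝ≥0∞ :=
  (posDefCoord n).indicator (fun w => ENNReal.ofReal (Real.exp (-∑ j, w.1 j))) w

theorem measurable_expTrace : Measurable (expTrace (n := n)) := by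
  refine Measurable.indicator ?_ measurableSet_posDefCoord
  fun_prop

/-- The weight of the first row and column. -/
def cornerWeight (q : ℝ × (Fin n → ℂ)) : ℝ≥0∞ :=
  (Set.Ioi (0 : ℝ)).indicator
    (fun c => ENNReal.ofReal (Real.exp (-c) * ∏ j, Real.exp (-(‖q.2 j‖ ^ 2 / c)))) q.1

/-- The trace is `c + ‖b‖² / c` plus the trace of the Schur complement, and positivity means `c > 0`
together with positivity of the complement. -/
theorem expTrace_succ (w : HermCoord (n + 1)) :
    expTrace w = cornerWeight (w.1 0, fun k => w.2 (zeroPair k)) * expTrace (schurCoord w) := by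
  by_cases hc : 0 < w.1 0
  · by_cases hs : schurCoord w ∈ posDefCoord n
    · rw [expTrace, Set.indicator_of_mem ((mem_posDefCoord_succ w).2 ⟨hc, hs⟩), expTrace,
        Set.indicator_of_mem hs, cornerWeight, Set.indicator_of_mem (by exact hc),
        ← ENNReal.ofReal_mul (by positivity), ← Real.exp_sum, ← Real.exp_add, ← Real.exp_add,
        Fin.sum_univ_succ]
      congr 2
      simp only [schurCoord, lowerBlockCoord, rankOneCoord, Prod.fst_sub, Pi.sub_apply,
        Finset.sum_sub_distrib, Finset.sum_neg_distrib]
      ring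
    · rw [expTrace, Set.indicator_of_notMem (fun h => hs ((mem_posDefCoord_succ w).1 h).2), expTrace,
        Set.indicator_of_notMem hs, mul_zero]
  · rw [expTrace, Set.indicator_of_notMem (fun h => hc ((mem_posDefCoord_succ w).1 h).1),
      cornerWeight, Set.indicator_of_notMem (by exact hc), zero_mul]

/-- The pairs `j < k` below `n + 1`, split by whether `j = 0`. -/
def pairSplit (n : ℕ) : Fin n ⊕ UpperPair n ≃ UpperPair (n + 1) :=
  Equiv.ofBijective (Sum.elim zeroPair succPair) (by
    constructor
    · rintro (k | p) (l | q) h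
      · have := congrArg (fun p : UpperPair (n + 1) => p.1.2) h
        exact congrArg Sum.inl (Fin.succ_injective _ this)
      · have := congrArg (fun p : UpperPair (n + 1) => p.1.1) h
        exact absurd this.symm (Fin.succ_ne_zero _)
      · have := congrArg (fun p : UpperPair (n + 1) => p.1.1) h
        exact absurd this (Fin.succ_ne_zero _)
      · have h1 := congrArg (fun p : UpperPair (n + 1) => p.1.1) h
        have h2 := congrArg (fun p : UpperPair (n + 1) => p.1.2) h
        exact congrArg Sum.inr
          (Subtype.ext (Prod.ext (Fin.succ_injective _ h1) (Fin.succ_injective _ h2)))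
    · rintro ⟨⟨j, k⟩, h⟩
      obtain ⟨k', rfl⟩ := Fin.exists_succ_eq.2 (Fin.ne_zero_of_lt h)
      rcases Fin.eq_zero_or_eq_succ j with rfl | ⟨j', rfl⟩
      · exact ⟨Sum.inl k', rfl⟩
      · exact ⟨Sum.inr ⟨(j', k'), Fin.succ_lt_succ_iff.1 h⟩, rfl⟩)

/-- Assembling coordinates of a hermitian matrix of size `n + 1`. -/
def joinCoord (q : (ℝ × (Fin n → ℂ)) × HermCoord n) : HermCoord (n + 1) :=
  ((MeasurableEquiv.piFinSuccAbove (fun _ => ℝ) 0).symm (q.1.1, q.2.1),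
    MeasurableEquiv.piCongrLeft (fun _ => ℂ) (pairSplit n)
      ((MeasurableEquiv.sumPiEquivProdPi fun _ => ℂ).symm (q.1.2, q.2.2)))

/-- Only a regrouping of product factors: `h1` to `h5` reorder them, `h6` joins the diagonal and
`h7` joins the entries below it. -/
theorem measurePreserving_joinCoord :
    MeasurePreserving (joinCoord (n := n)) := by
  have h1 := volume_preserving_prodAssoc (α₁ := ℝ) (β₁ := Fin n → ℂ) (γ₁ := HermCoord n)
  have h2 := (MeasurePreserving.id (volume : Measure ℝ)).prod
    (volume_preserving_prodAssoc (α₁ := Fin n → ℂ) (β₁ := Fin n → ℝ)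
      (γ₁ := UpperPair n → ℂ)).symm
  have h3 := (MeasurePreserving.id (volume : Measure ℝ)).prod
    ((Measure.measurePreserving_swap (μ := (volume : Measure (Fin n → ℂ)))
      (ν := (volume : Measure (Fin n → ℝ)))).prod
        (MeasurePreserving.id (volume : Measure (UpperPair n → ℂ))))
  have h4 := (MeasurePreserving.id (volume : Measure ℝ)).prod
    (volume_preserving_prodAssoc (α₁ := Fin n → ℝ) (β₁ := Fin n → ℂ)
      (γ₁ := UpperPair n → ℂ))
  have h5 := (volume_preserving_prodAssoc (α₁ := ℝ) (β₁ := Fin n → ℝ)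
      (γ₁ := (Fin n → ℂ) × (UpperPair n → ℂ))).symm
  have h6 := (volume_preserving_piFinSuccAbove (fun _ : Fin (n + 1) => ℝ) 0).symm
  have h7 := (volume_measurePreserving_piCongrLeft (fun _ => ℂ) (pairSplit n)).comp
    (volume_measurePreserving_sumPiEquivProdPi_symm fun _ => ℂ)
  exact (h6.prod h7).comp (h5.comp (h4.comp (h3.comp (h2.comp h1))))

theorem joinCoord_fst_zero (q : (ℝ × (Fin n → ℂ)) × HermCoord n) :
    (joinCoord q).1 0 = q.1.1 := rfl

theorem joinCoord_fst_succ (q : (ℝ × (Fin n → ℂ)) × HermCoord n) (j : Fin n) :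
    (joinCoord q).1 j.succ = q.2.1 j := rfl

theorem joinCoord_snd (q : (ℝ × (Fin n → ℂ)) × HermCoord n) (i : Fin n ⊕ UpperPair n) :
    (joinCoord q).2 (pairSplit n i) = Sum.elim q.1.2 q.2.2 i := by
  refine (MeasurableEquiv.piCongrLeft_apply_apply (pairSplit n) (β := fun _ => ℂ) _ i).trans ?_
  rcases i with k | p <;> rfl

theorem expTrace_joinCoord (q : (ℝ × (Fin n → ℂ)) × HermCoord n) :
    expTrace (joinCoord q) = cornerWeight q.1 * expTrace (q.2 - rankOneCoord q.1.1 q.1.2) := by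
  have h0 : (fun k => (joinCoord q).2 (zeroPair k)) = q.1.2 :=
    funext fun k => joinCoord_snd q (Sum.inl k)
  have h1 : lowerBlockCoord (joinCoord q) = q.2 :=
    Prod.ext (funext fun j => joinCoord_fst_succ q j)
      (funext fun p => joinCoord_snd q (Sum.inr p))
  rw [expTrace_succ, schurCoord, h0, h1, joinCoord_fst_zero]

theorem measurable_cornerWeight : Measurable (cornerWeight (n := n)) := by
  have h : cornerWeight (n := n) = ({q | 0 < q.1} : Set (ℝ × (Fin n → ℂ))).indicator
      fun q => ENNReal.ofReal (Real.exp (-q.1) * ∏ j, Real.exp (-(‖q.2 j‖ ^ 2 / q.1))) := by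
    funext q
    by_cases hq : 0 < q.1
    · rw [cornerWeight, Set.indicator_of_mem (by exact hq), Set.indicator_of_mem (by exact hq)]
    · rw [cornerWeight, Set.indicator_of_notMem (by exact hq),
        Set.indicator_of_notMem (by exact hq)]
  rw [h]
  exact Measurable.indicator (by fun_prop) (measurableSet_lt measurable_const measurable_fst)

theorem integral_complex_gaussian_div {c : ℝ} (hc : 0 < c) :
    ∫ z : ℂ, Real.exp (-(‖z‖ ^ 2 / c)) = Real.pi * c := by
  have h := Complex.integral_exp_neg_mul_rpow (p := 2) (b := c⁻¹) (by norm_num) (by positivity)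
  simp only [Real.rpow_ofNat] at h
  have h2 : ∀ z : ℂ, -(‖z‖ ^ 2 / c) = -c⁻¹ * ‖z‖ ^ 2 := fun z => by ring
  simp only [h2]
  rw [h]
  have h3 : (-2 : ℝ) / 2 = -1 := by norm_num
  have h4 : (2 : ℝ) / 2 + 1 = 2 := by norm_num
  rw [h3, h4, Real.rpow_neg_one, inv_inv, Real.Gamma_two, mul_one]

/-- For fixed `c` the Gaussian in `b` integrates to `(π c)^n`, and then `∫ c^n e^(-c) = n!`. -/
theorem lintegral_cornerWeight : ∫⁻ q : ℝ × (Fin n → ℂ), cornerWeight q =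
    ENNReal.ofReal (Real.pi ^ n * n.factorial) := by
  have hpi := Real.pi_pos
  rw [Measure.volume_eq_prod, lintegral_prod _ measurable_cornerWeight.aemeasurable]
  have h : ∀ c : ℝ, ∫⁻ b : Fin n → ℂ, cornerWeight (c, b) =
      (Set.Ioi (0 : ℝ)).indicator
        -- The exponent is left as `n + 1 - 1` to match the integral for `Γ(n + 1)`.
        (fun c => ENNReal.ofReal (Real.pi ^ n * (Real.exp (-c) * c ^ ((n : ℝ) + 1 - 1)))) c := by
    intro c
    by_cases hc : 0 < c
    · rw [Set.indicator_of_mem (by exact hc)]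
      have h1 : ∀ b : Fin n → ℂ, cornerWeight (c, b) = ENNReal.ofReal (Real.exp (-c)) *
          ENNReal.ofReal (∏ j, Real.exp (-(‖b j‖ ^ 2 / c))) := fun b => by
        rw [cornerWeight, Set.indicator_of_mem (by exact hc), ENNReal.ofReal_mul (by positivity)]
      simp_rw [h1]
      rw [lintegral_const_mul' _ _ ENNReal.ofReal_ne_top,
        lintegral_pi_prod_ofReal (fun _ (z : ℂ) => Real.exp (-(‖z‖ ^ 2 / c)))
          (fun _ _ => by positivity), ← ENNReal.ofReal_mul (by positivity)]
      · rw [integral_complex_gaussian_div hc, Finset.prod_const, Finset.card_univ, Fintype.card_fin,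
          add_sub_cancel_right, Real.rpow_natCast]
        congr 1
        ring
      · intro _
        refine Integrable.of_integral_ne_zero ?_
        rw [integral_complex_gaussian_div hc]
        positivity
    · rw [Set.indicator_of_notMem (by exact hc)]
      have h1 : ∀ b : Fin n → ℂ, cornerWeight (c, b) = 0 := fun b => by
        rw [cornerWeight, Set.indicator_of_notMem (by exact hc)]
      simp_rw [h1, lintegral_zero]
  simp_rw [h]
  rw [lintegral_indicator measurableSet_Ioi, ← ofReal_integral_eq_lintegral_ofReal]
  · rw [integral_const_mul, ← Real.Gamma_eq_integral (by positivity), Real.Gamma_nat_eq_factorial]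
  · exact (Real.GammaIntegral_convergent (by positivity)).const_mul _
  · filter_upwards [ae_restrict_mem measurableSet_Ioi] with c hc
    have : 0 < c := hc
    positivity

/-- For a fixed first row and column, passing to the Schur complement is a translation, which
Lebesgue measure does not see. -/
theorem lintegral_expTrace_succ : ∫⁻ w : HermCoord (n + 1), expTrace w =
    ENNReal.ofReal (Real.pi ^ n * n.factorial) * ∫⁻ w : HermCoord n, expTrace w := by
  rw [← measurePreserving_joinCoord.lintegral_comp measurable_expTrace]
  have hm : Measurable fun q : (ℝ × (Fin n → ℂ)) × HermCoord n => expTrace (joinCoord q) :=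
    measurable_expTrace.comp measurePreserving_joinCoord.measurable
  rw [Measure.volume_eq_prod, lintegral_prod _ hm.aemeasurable]
  simp_rw [expTrace_joinCoord]
  have h : ∀ q : ℝ × (Fin n → ℂ),
      ∫⁻ w : HermCoord n, cornerWeight q * expTrace (w - rankOneCoord q.1 q.2) =
        cornerWeight q * ∫⁻ w : HermCoord n, expTrace w := fun q => by
    have hs : Measurable fun w : HermCoord n => expTrace (w - rankOneCoord q.1 q.2) :=
      measurable_expTrace.comp (measurable_id.sub_const _)
    rw [lintegral_const_mul _ hs, lintegral_sub_right_eq_self expTrace]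
  simp_rw [h]
  rw [lintegral_mul_const _ measurable_cornerWeight, lintegral_cornerWeight]

theorem lintegral_expTrace (n : ℕ) : ∫⁻ w : HermCoord n, expTrace w =
    ENNReal.ofReal (∏ k ∈ Finset.range n, (Real.pi ^ k * k.factorial)) := by
  have hpi := Real.pi_pos
  induction n with
  | zero =>
    have h : ∀ w : HermCoord 0, expTrace w = 1 := fun w => by
      have hw : w ∈ posDefCoord 0 := by
        rw [mem_posDefCoord_iff]
        exact fun v hv => absurd (Subsingleton.elim v 0) hv
      rw [expTrace, Set.indicator_of_mem hw]
      simp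
    have : IsEmpty (UpperPair 0) := ⟨fun p => p.1.1.elim0⟩
    simp_rw [h]
    rw [lintegral_one, Measure.volume_eq_prod, ← Set.univ_prod_univ, Measure.prod_prod,
      ← Set.pi_univ Set.univ, volume_pi_pi, ← Set.pi_univ Set.univ, volume_pi_pi]
    simp
  | succ n ih =>
    rw [lintegral_expTrace_succ, ih, ← ENNReal.ofReal_mul (by positivity),
      Finset.prod_range_succ, mul_comm]

theorem complexMatrixGamma_nat (n : ℕ) : complexMatrixGamma n n =
    ((Real.pi ^ (n * (n - 1) / 2) *
      ((∏ k ∈ Finset.Icc 1 (n - 1), k.factorial : ℕ) : ℝ) : ℝ) : ℂ) := by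
  have hpi := Real.pi_pos
  have htr : ∀ w : HermCoord n, (hermitianOf w.1 w.2).trace = ((∑ j, w.1 j : ℝ) : ℂ) := fun w => by
    rw [Matrix.trace]
    push_cast
    exact Finset.sum_congr rfl fun j _ => hermitianOf_diag _ _ _
  have hint : ∀ w : HermCoord n, ((‖(hermitianOf w.1 w.2).det‖ : ℝ) : ℂ) ^ ((n : ℂ) - n) *
      Complex.exp (-(hermitianOf w.1 w.2).trace) = ((Real.exp (-∑ j, w.1 j) : ℝ) : ℂ) := fun w => by
    -- At `α = n` the exponent of the determinant is zero.
    rw [sub_self, Complex.cpow_zero, one_mul, htr]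
    push_cast
    rfl
  rw [complexMatrixGamma]
  simp_rw [hint]
  rw [integral_complex_ofReal, integral_eq_lintegral_of_nonneg_ae
    (Filter.Eventually.of_forall fun w => by positivity)
    (Measurable.aestronglyMeasurable (by fun_prop))]
  have h := lintegral_expTrace n
  simp only [expTrace] at h
  rw [lintegral_indicator measurableSet_posDefCoord] at h
  have h' : ∫⁻ w in {w : (Fin n → ℝ) × (UpperPair n → ℂ) | (hermitianOf w.1 w.2).PosDef},
      ENNReal.ofReal (Real.exp (-∑ j, w.1 j)) =
        ENNReal.ofReal (∏ k ∈ Finset.range n, (Real.pi ^ k * k.factorial)) := h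
  rw [h', ENNReal.toReal_ofReal (by positivity), Finset.prod_mul_distrib,
    Finset.prod_pow_eq_pow_sum, Finset.sum_range_id, prod_range_factorial]
  push_cast
  rfl

end

/-! ### The flag manifold -/

theorem measurable_toFlag (n : ℕ) : Measurable (toFlag n) :=
  (measurable_quotient_mk'' (s := QuotientGroup.leftRel (diagonalTorus n))).comp
    (Measurable.subtype_mk measurable_subtype_coe)

theorem toFlag_surjective (n : ℕ) : Function.Surjective (toFlag n) := by
  intro q
  obtain ⟨U, rfl⟩ := QuotientGroup.mk_surjective q
  -- Multiplying column `j` by the conjugate phase of its diagonal entry makes that entry equal to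
  -- its modulus. If the entry is zero any phase works, and `1` is taken.
  let d : Fin n → ℂ := fun j => if U.1 j j = 0 then 1 else star (U.1 j j) / (‖U.1 j j‖ : ℂ)
  have hd : ∀ j, d j * star (d j) = 1 := fun j => by
    by_cases h : U.1 j j = 0
    · simp [d, h]
    · have h' : ((‖U.1 j j‖ : ℝ) : ℂ) ≠ 0 := Complex.ofReal_ne_zero.2 (norm_ne_zero_iff.2 h)
      have h2 : star (U.1 j j) * U.1 j j = ((‖U.1 j j‖ : ℝ) : ℂ) ^ 2 := Complex.conj_mul' _
      simp only [d, h, if_false, star_div₀, star_star, star_complex_ofReal]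
      rw [div_mul_div_comm, h2, ← pow_two, div_self (pow_ne_zero _ h')]
  have hD : Matrix.diagonal d ∈ Matrix.unitaryGroup (Fin n) ℂ := by
    rw [Matrix.mem_unitaryGroup_iff, Matrix.star_eq_conjTranspose, Matrix.diagonal_conjTranspose,
      Matrix.diagonal_mul_diagonal, ← Matrix.diagonal_one]
    exact congrArg Matrix.diagonal (funext hd)
  let D : Matrix.unitaryGroup (Fin n) ℂ := ⟨Matrix.diagonal d, hD⟩
  have hDmem : D ∈ diagonalTorus n := Matrix.isDiag_diagonal d
  refine ⟨⟨(U * D).1, (U * D).2, fun j => ?_⟩, ?_⟩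
  · have hj : (U * D).1 j j = ((‖U.1 j j‖ : ℝ) : ℂ) := by
      change (U.1 * Matrix.diagonal d) j j = _
      rw [Matrix.mul_diagonal]
      by_cases h : U.1 j j = 0
      · simp [h]
      · have h' : ((‖U.1 j j‖ : ℝ) : ℂ) ≠ 0 := Complex.ofReal_ne_zero.2 (norm_ne_zero_iff.2 h)
        have h2 : U.1 j j * star (U.1 j j) = ((‖U.1 j j‖ : ℝ) : ℂ) ^ 2 := Complex.mul_conj' _
        simp only [d, h, if_false]
        rw [← mul_div_assoc, h2, pow_two, mul_div_cancel_right₀ _ h']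
    rw [hj]
    exact ⟨Complex.ofReal_im _, by rw [Complex.ofReal_re]; exact norm_nonneg _⟩
  · exact QuotientGroup.mk_mul_of_mem U hDmem

/-- Two representatives of a coset differ by a diagonal unitary matrix; positive diagonal entries in
both leave no phase free. -/
theorem injOn_toFlag (n : ℕ) : Set.InjOn (toFlag n) (Subtype.val ⁻¹' posDiag n) := by
  intro V hV W hW h
  have hmem := QuotientGroup.eq.1 h
  set M : Matrix (Fin n) (Fin n) ℂ := V.1.conjTranspose * W.1 with hM
  have hdiag : M.IsDiag := hmem
  have hVW : V.1 * M = W.1 := by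
    rw [hM, ← Matrix.mul_assoc, realDiagUnitary.mul_star V.2, Matrix.one_mul]
  have hMlow : IsLower M := fun j k hjk => hdiag hjk.ne
  have hMM : M * M.conjTranspose = 1 := by
    rw [hM, Matrix.conjTranspose_mul, Matrix.conjTranspose_conjTranspose, Matrix.mul_assoc,
      ← Matrix.mul_assoc W.1, realDiagUnitary.mul_star W.2, Matrix.one_mul,
      realDiagUnitary.star_mul V.2]
  obtain ⟨-, hn⟩ := hMlow.diag_of_unitary hMM
  have hM1 : M = 1 := by
    ext j k
    by_cases hjk : j = k
    · subst hjk
      have h1 : W.1 j j = V.1 j j * M j j := by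
        conv_lhs => rw [← hVW]
        rw [Matrix.mul_apply, Finset.sum_eq_single j
          (fun l _ hl => by rw [hdiag hl, mul_zero]) (by simp)]
      have hVj : V.1 j j = ((V.1 j j).re : ℂ) := Complex.ext rfl ((V.2.2 j).1)
      have hWj : W.1 j j = ((W.1 j j).re : ℂ) := Complex.ext rfl ((W.2.2 j).1)
      have hn' : ‖W.1 j j‖ = ‖V.1 j j‖ := by rw [h1, norm_mul, hn j, mul_one]
      rw [hVj, hWj, Complex.norm_of_nonneg (hV j).le, Complex.norm_of_nonneg (hW j).le] at hn'
      rw [hVj, hWj, hn'] at h1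
      have h0 : ((V.1 j j).re : ℂ) ≠ 0 := Complex.ofReal_ne_zero.2 (hV j).ne'
      rw [Matrix.one_apply_eq]
      exact (mul_left_cancel₀ h0 (by rw [mul_one]; exact h1)).symm
    · rw [hdiag hjk, Matrix.one_apply_ne hjk]
  rw [hM1, Matrix.mul_one] at hVW
  exact Subtype.ext hVW

theorem dGMeasure_compl_posDiag (n : ℕ) :
    dGMeasure n (Subtype.val ⁻¹' posDiag n)ᶜ = 0 := by
  rw [dGMeasure_apply]
  refine measure_mono_null ?_ (chart n).measure_compl_posDiag
  rintro _ ⟨V, hV, rfl⟩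
  exact hV

theorem pow_add_self_div_mul {K : Type*} [Field K] {x : K} (hx : x ≠ 0) {a m : ℕ} (h : a = m + m)
    (c : K) : x ^ a / (x ^ m * c) = x ^ m / c := by
  rw [h, pow_add, mul_div_mul_left _ _ (pow_ne_zero _ hx)]

theorem mainTheorem6 (n : ℕ) (hn : 1 ≤ n) :
    Function.Surjective (toFlag n) ∧
    (∃ N : Set (realDiagUnitary n), dGMeasure n N = 0 ∧ Set.InjOn (toFlag n) Nᶜ) ∧
    flagMeasure n Set.univ = dGMeasure n Set.univ ∧
    dGMeasure n Set.univ ≠ ⊤ ∧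
    (((dGMeasure n Set.univ).toReal : ℝ) : ℂ) =
      (Real.pi : ℂ) ^ (n * (n - 1)) / complexMatrixGamma n (n : ℂ) ∧
    (Real.pi : ℂ) ^ (n * (n - 1)) / complexMatrixGamma n (n : ℂ) =
      (Real.pi : ℂ) ^ (n * (n - 1) / 2) / ((∏ k ∈ Finset.Icc 1 (n - 1), k.factorial : ℕ) : ℂ) := by
  have hpi := Real.pi_pos
  have hf : (0 : ℝ) < ((∏ k ∈ Finset.Icc 1 (n - 1), k.factorial : ℕ) : ℝ) := by
    exact_mod_cast Finset.prod_pos fun k _ => Nat.factorial_pos k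
  -- The product `n (n - 1)` is even, so the natural number division in the exponent is exact.
  have hexp : n * (n - 1) = n * (n - 1) / 2 + n * (n - 1) / 2 := by
    rw [← two_mul, Nat.mul_div_cancel' (Nat.even_mul_pred_self n).two_dvd]
  have hratio : (Real.pi : ℂ) ^ (n * (n - 1)) / complexMatrixGamma n (n : ℂ) =
      (Real.pi : ℂ) ^ (n * (n - 1) / 2) /
        ((∏ k ∈ Finset.Icc 1 (n - 1), k.factorial : ℕ) : ℂ) := by
    rw [complexMatrixGamma_nat, Complex.ofReal_mul, Complex.ofReal_pow, Complex.ofReal_natCast]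
    exact pow_add_self_div_mul (Complex.ofReal_ne_zero.2 hpi.ne') hexp _
  refine ⟨toFlag_surjective n, ⟨(Subtype.val ⁻¹' posDiag n)ᶜ, dGMeasure_compl_posDiag n, ?_⟩, ?_,
    ?_, ?_, hratio⟩
  · rw [compl_compl]
    exact injOn_toFlag n
  · rw [flagMeasure, Measure.map_apply (measurable_toFlag n) MeasurableSet.univ, Set.preimage_univ]
  · rw [dGMeasure_univ_eq]
    exact ENNReal.ofReal_ne_top
  · rw [hratio, dGMeasure_univ_eq, ENNReal.toReal_ofReal (by positivity), Complex.ofReal_div,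
      Complex.ofReal_pow, Complex.ofReal_natCast]
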